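/- Let $p$ be a prime. For $A,B\in\mathfrak{sl}_2(\mathbb F_p)$, the random Lie bracket is the Markov chain $X_0=[A,B]$, $X_k=[Z_k,X_{k-1}]$ for $k\ge 1$, where $Z_1,Z_2,\dots$ are independent and uniformly distributed in $\{A,B\}$; let $\mu_{2k}$ (which depends on $A,B$) be the law of $X_{2k}$. When $[A,B]\neq 0$, identify $\mathbb F_p^\ast$ with $\operatorname{lin}\{[A,B]\}\setminus\{0\}$ by $t\mapsto t[A,B]$. Write $d_{TV}(\mu,\nu)=\frac12\|\mu-\nu\|_1$ for the total variation distance. For all $\delta,\varepsilon>0$ there are constants $C,c>0$ such that the following holds for every prime $p>C$. To each pair $A,B\in\mathfrak{sl}_2(\mathbb F_p)$ with $[A,B]\ne 0$ one can associate probability distributions $\nu_{2k}$ ($k\ge 0$) of the following form: there are a subgroup $H\le\mathbb F_p^\ast$ and an element $g\in\mathbb F_p^\ast$, depending only on $A,B$, such that for every $k\ge 0$, $\nu_{2k}$ is uniform on the coset $g^kH$ of $H$ in $\mathbb F_p^\ast=\operatorname{lin}\{[A,B]\}\setminus\{0\}$. Moreover, if $A,B$ are independent and uniformly random in $\mathfrak{sl}_2(\mathbb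 F_p)$, then with probability at least $1-\delta$ we have $[A,B]\neq0$, $d_{TV}(\mu_{2k},\nu_{2k})\to 0$ as $k\to\infty$, and 1. for every integer $k\ge 0$ with $k<cp$, $d_{TV}(\mu_{2k},\nu_{2k})>1-\varepsilon$; 2. for every integer $k$ with $k>Cp$, $d_{TV}(\mu_{2k},\nu_{2k})<\varepsilon$. -/

import Mathlib

open Filter Topology
open scoped Pointwise

noncomputable section

/-- The Lie algebra of trace-zero `2 × 2` matrices over the field with `p` elements. -/
abbrev SL2Lie (p : ℕ) : Type := LieAlgebra.SpecialLinear.sl (Fin 2) (ZMod p)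

open Classical in
/-- The law of `X k`, where `X 0 = ⁅A, B⁆` and `X (k + 1) = ⁅Z (k + 1), X k⁆` with
`Z 1, Z 2, …` independent and uniformly distributed in the set `{A, B}`. -/
def lieBracketLaw {p : ℕ} (A B : SL2Lie p) : ℕ → PMF (SL2Lie p)
  | 0 => PMF.pure ⁅A, B⁆
  | k + 1 => (lieBracketLaw A B k).bind fun X =>
      (PMF.uniformOfFinset ({A, B} : Finset (SL2Lie p)) ⟨A, Finset.mem_insert_self A {B}⟩).map
        fun Z => ⁅Z, X⁆

/-- Total variation distance between two discrete probability distributions. -/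
def tvDist {α : Type*} (μ ν : PMF α) : ℝ :=
  (1 / 2) * ∑' x, |(μ x).toReal - (ν x).toReal|

/-- `ν` is the uniform distribution on the finite nonempty set `S`. -/
def IsUniformOn {α : Type*} (ν : PMF α) (S : Set α) : Prop :=
  ∃ (hfin : S.Finite) (hne : hfin.toFinset.Nonempty),
    ν = PMF.uniformOfFinset hfin.toFinset hne

/-- The subset of the punctured line `{t • V | t ≠ 0}` that corresponds to a set `T` of units
under the identification `t ↦ t • V`. -/
def onLine {p : ℕ} (V : SL2Lie p) (T : Set (ZMod p)ˣ) : Set (SL2Lie p) :=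
  (fun t : (ZMod p)ˣ => (t : ZMod p) • V) '' T

/-- The probability that a uniformly random pair `(A, B)` satisfies `P`. -/
def pairProb (p : ℕ) (P : SL2Lie p → SL2Lie p → Prop) : ℝ :=
  (Nat.card {AB : SL2Lie p × SL2Lie p // P AB.1 AB.2} : ℝ) / Nat.card (SL2Lie p × SL2Lie p)

end

/-! Two bracketings by elements of `{A, B}` act on the line through `⁅A, B⁆` as a scalar
(`double_bracket_smul`): `⟨A,A⟩` or `⟨B,B⟩` with probability 1/4 each, `⟨A,B⟩` with probability 1/2,
where `⟨·,·⟩` is `bracketForm`. If these scalars are nonzero, discrete logarithms turn the even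
steps into a walk on `ZMod n`, `n = p - 1`, with increments `α`, `β`, `γ`. Put `x = α - γ`, `y = β -
γ`. After `k` steps the walk lives on the coset of `⟨x, y⟩` through `k • γ`, and converges to the
uniform law there.

Upper bound: Plancherel and Cauchy-Schwarz bound the squared `L¹` distance by `spectralSum x y k`
(`sq_sum_abs_sub_le_spectralSum`). Its average over all `(x, y)` is at most `12 n / k`
(`sum_spectralSum_le`), so by Markov's inequality it is small for most `(x, y)` once `k` is a large
multiple of `n`.

Lower bound: the group is abelian, so the position depends only on the numbers of steps of each
kind. These fluctuate by `√k` in two directions, so most of the mass sits on `O(k)` points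
(`exists_small_set_walkWeight`), whereas `⟨x, y⟩` usually has bounded index
(`card_filter_card_closure_le`).

Transfer: a Gram matrix has at most `2 p ^ 3` preimages among pairs with `A.1 0 1 ≠ 0`, so
properties of most `(x, y)` hold for most `(A, B)` (`le_pairProb`). -/

/-! ### Random walks on `ZMod n` and their Fourier transform -/

section Walk

variable {n : ℕ}

/-- The distribution after `k` steps of the walk on `ZMod n`, started at `0`, whose increments are
`α`, `β`, `γ` with probabilities `1/4`, `1/4`, `1/2`. -/
noncomputable def walkWeight (α β γ : ZMod n) : ℕ → ZMod n → ℝ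
  | 0 => fun t => if t = 0 then 1 else 0
  | k + 1 => fun t => walkWeight α β γ k (t - α) / 4 + walkWeight α β γ k (t - β) / 4 +
      walkWeight α β γ k (t - γ) / 2

open Classical in
/-- The density of the uniform distribution on the coset `g + H`. -/
noncomputable def cosetWeight (H : AddSubgroup (ZMod n)) (g : ZMod n) (t : ZMod n) : ℝ :=
  if t - g ∈ H then (Nat.card H : ℝ)⁻¹ else 0

open Classical in
theorem cosetWeight_congr (H : AddSubgroup (ZMod n)) {g t g' t' : ZMod n}
    (h : t - g ∈ H ↔ t' - g' ∈ H) : cosetWeight H g t = cosetWeight H g' t' :=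
  if_congr h rfl rfl

theorem cosetWeight_add_right (H : AddSubgroup (ZMod n)) (g t : ZMod n) :
    cosetWeight H g (t + g) = cosetWeight H 0 t :=
  cosetWeight_congr H (by rw [add_sub_cancel_right, sub_zero])

variable [NeZero n]

/-- The eigenvalue of the lazy walk at a character taking the arguments `s` and `t`. -/
noncomputable def walkEigenvalue (s t : ZMod n) : ℂ :=
  1 / 2 + ZMod.stdAddChar s / 4 + ZMod.stdAddChar t / 4

/-- The sum of `‖λ‖ ^ (2 * k)` over the eigenvalues of the non-trivial characters. -/
noncomputable def spectralSum (x y : ZMod n) (k : ℕ) : ℝ :=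
  ∑ j : ZMod n with ¬ (j * x = 0 ∧ j * y = 0), ‖walkEigenvalue (j * x) (j * y)‖ ^ (2 * k)

/-- Fourier transform of a real function on `ZMod n`. -/
noncomputable def fourierSum (f : ZMod n → ℝ) (j : ZMod n) : ℂ :=
  ∑ t, (f t : ℂ) * ZMod.stdAddChar (j * t)

/-- Plancherel's identity, from orthogonality of the characters. -/
theorem sum_norm_sq_fourierSum (f : ZMod n → ℝ) :
    ∑ j, ‖fourierSum f j‖ ^ 2 = n * ∑ t, f t ^ 2 := by
  have key : ∀ j, ((‖fourierSum f j‖ ^ 2 : ℝ) : ℂ) =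
      ∑ s, ∑ t, (f s : ℂ) * f t * ZMod.stdAddChar (j * (s - t)) := by
    intro j
    rw [Complex.ofReal_pow, ← Complex.mul_conj', fourierSum, map_sum (starRingEnd ℂ), Finset.sum_mul_sum]
    refine Finset.sum_congr rfl fun s _ => Finset.sum_congr rfl fun t _ => ?_
    rw [map_mul (starRingEnd ℂ), Complex.conj_ofReal, ← AddChar.map_neg_eq_conj, mul_sub, sub_eq_add_neg,
      AddChar.map_add_eq_mul]
    ring
  have h : ((∑ j, ‖fourierSum f j‖ ^ 2 : ℝ) : ℂ) = ((n * ∑ t, f t ^ 2 : ℝ) : ℂ) := by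
    rw [Complex.ofReal_sum]
    simp only [key]
    rw [Finset.sum_comm]
    push_cast
    rw [Finset.mul_sum]
    refine Finset.sum_congr rfl fun s _ => ?_
    rw [Finset.sum_comm]
    simp only [← Finset.mul_sum, AddChar.sum_mulShift _ (ZMod.isPrimitive_stdAddChar n),
      sub_eq_zero, ZMod.card]
    simp
    ring
  exact_mod_cast h

/-- Each step is a convolution, so it multiplies the transform by that of the step distribution. -/
theorem fourierSum_walkWeight (α β γ : ZMod n) (k : ℕ) (j : ZMod n) :
    fourierSum (walkWeight α β γ k) j =
      (ZMod.stdAddChar (j * α) / 4 + ZMod.stdAddChar (j * β) / 4 +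
        ZMod.stdAddChar (j * γ) / 2) ^ k := by
  induction k with
  | zero =>
    rw [fourierSum, Finset.sum_eq_single 0 (fun t _ ht => by simp [walkWeight, ht]) (by simp)]
    simp [walkWeight]
  | succ k ih =>
    have shift : ∀ δ : ZMod n,
        ∑ t, (walkWeight α β γ k (t - δ) : ℂ) * ZMod.stdAddChar (j * t) =
          fourierSum (walkWeight α β γ k) j * ZMod.stdAddChar (j * δ) := by
      intro δ
      rw [← Equiv.sum_comp (Equiv.addRight δ), fourierSum, Finset.sum_mul]
      refine Finset.sum_congr rfl fun t _ => ?_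
      simp [mul_add, AddChar.map_add_eq_mul, mul_assoc]
    have h : fourierSum (walkWeight α β γ (k + 1)) j =
        (∑ t, (walkWeight α β γ k (t - α) : ℂ) * ZMod.stdAddChar (j * t)) / 4 +
        (∑ t, (walkWeight α β γ k (t - β) : ℂ) * ZMod.stdAddChar (j * t)) / 4 +
        (∑ t, (walkWeight α β γ k (t - γ) : ℂ) * ZMod.stdAddChar (j * t)) / 2 := by
      rw [fourierSum, Finset.sum_div, Finset.sum_div, Finset.sum_div, ← Finset.sum_add_distrib,
        ← Finset.sum_add_distrib]
      refine Finset.sum_congr rfl fun t _ => ?_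
      simp only [walkWeight]
      push_cast
      ring
    rw [h, shift, shift, shift, ih]
    ring

theorem fourierSum_cosetWeight (H : AddSubgroup (ZMod n)) (g j : ZMod n) :
    fourierSum (cosetWeight H g) j =
      ZMod.stdAddChar (j * g) * fourierSum (cosetWeight H 0) j := by
  rw [fourierSum, ← Equiv.sum_comp (Equiv.addRight g), fourierSum, Finset.mul_sum]
  refine Finset.sum_congr rfl fun t _ => ?_
  rw [Equiv.coe_addRight, cosetWeight_add_right, mul_add, AddChar.map_add_eq_mul]
  ring

open Classical in
theorem sum_cosetWeight (H : AddSubgroup (ZMod n)) (g : ZMod n) :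
    ∑ t, cosetWeight H g t = 1 := by
  rw [← Equiv.sum_comp (Equiv.addRight g)]
  simp only [Equiv.coe_addRight, cosetWeight_add_right]
  simp only [cosetWeight, sub_zero]
  rw [← Finset.sum_filter, Finset.sum_const, nsmul_eq_mul]
  have : (Finset.univ.filter fun t : ZMod n => t ∈ H).card = Nat.card H := by
    rw [Nat.card_eq_fintype_card, Fintype.card_subtype]
  rw [this, mul_inv_cancel₀]
  exact_mod_cast Nat.card_pos.ne'

theorem fourierSum_cosetWeight_zero_of_trivial (H : AddSubgroup (ZMod n)) (j : ZMod n)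
    (hj : ∀ h ∈ H, j * h = 0) : fourierSum (cosetWeight H 0) j = 1 := by
  have : fourierSum (cosetWeight H 0) j = ((∑ t, cosetWeight H 0 t : ℝ) : ℂ) := by
    rw [Complex.ofReal_sum]
    refine Finset.sum_congr rfl fun t _ => ?_
    by_cases ht : t ∈ H
    · simp [hj t ht]
    · simp [cosetWeight, ht]
  rw [this, sum_cosetWeight, Complex.ofReal_one]

/-- Translation by `h` preserves the uniform law on `H` but multiplies its transform by a phase
different from 1. -/
theorem fourierSum_cosetWeight_zero_of_nontrivial (H : AddSubgroup (ZMod n)) (j h : ZMod n)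
    (hh : h ∈ H) (hj : j * h ≠ 0) : fourierSum (cosetWeight H 0) j = 0 := by
  have h1 : fourierSum (cosetWeight H 0) j =
      ZMod.stdAddChar (j * h) * fourierSum (cosetWeight H 0) j := by
    rw [← fourierSum_cosetWeight]
    refine Finset.sum_congr rfl fun t _ => ?_
    rw [cosetWeight_congr H (g' := h) (t' := t)]
    rw [sub_zero, sub_eq_add_neg, H.add_mem_cancel_right (H.neg_mem hh)]
  have h2 : (ZMod.stdAddChar (j * h) : ℂ) ≠ 1 := by
    rw [← AddChar.map_zero_eq_one (ZMod.stdAddChar (N := n))]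
    exact fun e => hj (ZMod.injective_stdAddChar e)
  have h3 : (1 - ZMod.stdAddChar (j * h)) * fourierSum (cosetWeight H 0) j = 0 := by
    linear_combination h1
  exact (mul_eq_zero.1 h3).resolve_left (sub_ne_zero.2 h2.symm)

/-- Both transforms carry the same phase, the `k`-th power of the character at `j * γ`. Without it,
the coset contributes 1 at characters trivial on the subgroup, cancelling the eigenvalue 1 of the
walk, and 0 at all others, where the eigenvalue's power remains. -/
theorem norm_fourierSum_sub (α β γ : ZMod n) (k : ℕ) (j : ZMod n) :
    ‖fourierSum (fun t => walkWeight α β γ k t -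
        cosetWeight (AddSubgroup.closure {α - γ, β - γ}) (k • γ) t) j‖ ^ 2 =
      if ¬ (j * (α - γ) = 0 ∧ j * (β - γ) = 0) then
        ‖walkEigenvalue (j * (α - γ)) (j * (β - γ))‖ ^ (2 * k) else 0 := by
  have hsub : fourierSum (fun t => walkWeight α β γ k t -
        cosetWeight (AddSubgroup.closure {α - γ, β - γ}) (k • γ) t) j =
      fourierSum (walkWeight α β γ k) j -
        fourierSum (cosetWeight (AddSubgroup.closure {α - γ, β - γ}) (k • γ)) j := by
    simp only [fourierSum, ← Finset.sum_sub_distrib, Complex.ofReal_sub, sub_mul]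
  rw [hsub, fourierSum_walkWeight, fourierSum_cosetWeight]
  have hα : j * α = j * (α - γ) + j * γ := by ring
  have hβ : j * β = j * (β - γ) + j * γ := by ring
  have hw : (ZMod.stdAddChar (j * α) / 4 + ZMod.stdAddChar (j * β) / 4 +
        ZMod.stdAddChar (j * γ) / 2 : ℂ) =
      ZMod.stdAddChar (j * γ) * walkEigenvalue (j * (α - γ)) (j * (β - γ)) := by
    rw [hα, hβ, AddChar.map_add_eq_mul, AddChar.map_add_eq_mul, walkEigenvalue]
    ring
  rw [hw, mul_pow, mul_smul_comm, AddChar.map_nsmul_eq_pow]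
  by_cases hj : ¬ (j * (α - γ) = 0 ∧ j * (β - γ) = 0)
  · rw [if_pos hj]
    have h0 : fourierSum (cosetWeight (AddSubgroup.closure {α - γ, β - γ}) 0) j = 0 := by
      rw [not_and_or] at hj
      rcases hj with hj | hj
      · exact fourierSum_cosetWeight_zero_of_nontrivial _ _ _
          (AddSubgroup.subset_closure (by simp)) hj
      · exact fourierSum_cosetWeight_zero_of_nontrivial _ _ _
          (AddSubgroup.subset_closure (by simp)) hj
    rw [h0, mul_zero, sub_zero, norm_mul, norm_pow, AddChar.norm_apply, one_pow, one_mul,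
      norm_pow, ← pow_mul, mul_comm k 2]
  · rw [if_neg hj]
    rw [not_not] at hj
    have h1 : fourierSum (cosetWeight (AddSubgroup.closure {α - γ, β - γ}) 0) j = 1 := by
      apply fourierSum_cosetWeight_zero_of_trivial
      intro h hh
      induction hh using AddSubgroup.closure_induction with
      | mem x hx =>
        rcases hx with rfl | hx
        · exact hj.1
        · rw [Set.mem_singleton_iff] at hx; rw [hx]; exact hj.2
      | zero => simp
      | add x y _ _ hx hy => rw [mul_add, hx, hy, add_zero]
      | neg x _ hx => rw [mul_neg, hx, neg_zero]
    have hev : walkEigenvalue (j * (α - γ)) (j * (β - γ)) = 1 := by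
      rw [hj.1, hj.2, walkEigenvalue, AddChar.map_zero_eq_one]
      norm_num
    rw [h1, hev]
    simp

/-- The upper bound lemma: the `L¹` distance of the walk to the uniform distribution on a coset is
controlled by the non-trivial eigenvalues. -/
theorem sq_sum_abs_sub_le_spectralSum (α β γ : ZMod n) (k : ℕ) :
    (∑ t, |walkWeight α β γ k t -
        cosetWeight (AddSubgroup.closure {α - γ, β - γ}) (k • γ) t|) ^ 2 ≤
      spectralSum (α - γ) (β - γ) k := by
  have h := sum_norm_sq_fourierSum (fun t => walkWeight α β γ k t -
    cosetWeight (AddSubgroup.closure {α - γ, β - γ}) (k • γ) t)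
  simp only [norm_fourierSum_sub] at h
  rw [spectralSum, Finset.sum_filter, h]
  refine (sq_sum_le_card_mul_sum_sq).trans ?_
  simp

end Walk

/-! ### Eigenvalue bounds, their second moment over the increments, and the index of a two-generated
subgroup -/

section Spectral

/-- Telescoping comparison, using `(1 + t) ^ 2 ≤ 2 * (1 + t ^ 2)`. The `1 / b` bound will control
the square of a tail sum, and the `1 / b ^ 2` bound of the next lemma its linear term. -/
theorem sum_Ioo_one_div_one_add_sq_le (b : ℝ) (hb : 0 < b) (N : ℕ) :
    ∑ i ∈ Finset.Ioo 0 N, 1 / (1 + b ^ 2 * (i : ℝ) ^ 2) ≤ 2 / b := by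
  have key : ∀ M : ℕ, ∑ i ∈ Finset.range M, 1 / (1 + b ^ 2 * ((i + 1 : ℕ) : ℝ) ^ 2) ≤
      2 / b - 2 / (b * (1 + b * M)) := by
    intro M
    induction M with
    | zero => simp
    | succ M ih =>
      rw [Finset.sum_range_succ]
      have h1 : 1 / (1 + b ^ 2 * ((M + 1 : ℕ) : ℝ) ^ 2) ≤
          2 / (b * (1 + b * M)) - 2 / (b * (1 + b * (M + 1 : ℕ))) := by
        push_cast
        have hM : (0 : ℝ) ≤ M := Nat.cast_nonneg M
        have e : 2 / (b * (1 + b * M)) - 2 / (b * (1 + b * (M + 1 : ℝ))) =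
            2 / ((1 + b * M) * (1 + b * (M + 1 : ℝ))) := by
          have : 1 + b * (M : ℝ) ≠ 0 := by positivity
          have : 1 + b * ((M : ℝ) + 1) ≠ 0 := by positivity
          field_simp
          ring
        rw [e, div_le_div_iff₀ (by positivity) (by positivity)]
        nlinarith [sq_nonneg (b * (M + 1) - 1), mul_nonneg hb.le hM, mul_pos hb hb]
      linarith
  rcases N with _ | M
  · simp; positivity
  · have e : ∑ i ∈ Finset.Ioo 0 (M + 1), 1 / (1 + b ^ 2 * (i : ℝ) ^ 2) =
        ∑ i ∈ Finset.range M, 1 / (1 + b ^ 2 * ((i + 1 : ℕ) : ℝ) ^ 2) := by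
      rw [Finset.sum_bij' (fun i _ => i - 1) (fun i _ => i + 1)]
      · intro i hi; simp at hi ⊢; omega
      · intro i hi; simp at hi ⊢; omega
      · intro i hi; simp at hi ⊢; omega
      · intro i hi; simp
      · intro i hi
        simp only [Finset.mem_Ioo] at hi
        rw [Nat.sub_add_cancel hi.1]
    rw [e]
    refine (key M).trans ?_
    have : 0 ≤ 2 / (b * (1 + b * (M : ℝ))) := by positivity
    linarith

theorem sum_Ioo_one_div_one_add_sq_le' (b : ℝ) (hb : 0 < b) (N : ℕ) :
    ∑ i ∈ Finset.Ioo 0 N, 1 / (1 + b ^ 2 * (i : ℝ) ^ 2) ≤ 2 / b ^ 2 := by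
  have h : ∑ i ∈ Finset.Ioo 0 N, 1 / (1 + b ^ 2 * (i : ℝ) ^ 2) ≤
      ∑ i ∈ Finset.Ioo 0 N, (1 / b ^ 2) * ((i : ℝ) ^ 2)⁻¹ := by
    refine Finset.sum_le_sum fun i hi => ?_
    have : (0 : ℝ) < i := by exact_mod_cast (Finset.mem_Ioo.1 hi).1
    rw [← one_div, div_mul_div_comm, one_mul]
    exact one_div_le_one_div_of_le (by positivity) (by linarith)
  refine h.trans ?_
  rw [← Finset.mul_sum]
  have := sum_Ioo_inv_sq_le (α := ℝ) 0 N
  calc (1 / b ^ 2) * ∑ i ∈ Finset.Ioo 0 N, ((i : ℝ) ^ 2)⁻¹ ≤ (1 / b ^ 2) * 2 := by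
        gcongr; simpa using this
    _ = 2 / b ^ 2 := by ring

/-- A sum of an even function over non-zero integers is at most twice a sum over positive ones. -/
theorem sum_int_le_two_mul_sum_Ioo (f : ℕ → ℝ) (hf : ∀ i, 0 ≤ f i) (I : Finset ℤ) (hI : 0 ∉ I) :
    ∃ N : ℕ, ∑ i ∈ I, f i.natAbs ≤ 2 * ∑ i ∈ Finset.Ioo 0 N, f i := by
  refine ⟨I.sup Int.natAbs + 1, ?_⟩
  set J := Finset.Ioo 0 (I.sup Int.natAbs + 1)
  have hsub : I ⊆ J.image (fun i : ℕ => (i : ℤ)) ∪ J.image (fun i : ℕ => -(i : ℤ)) := by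
    intro i hi
    have h0 : i ≠ 0 := fun h => hI (h ▸ hi)
    have hJ : i.natAbs ∈ J := Finset.mem_Ioo.2
      ⟨Int.natAbs_pos.2 h0, Nat.lt_succ_of_le (Finset.le_sup (f := Int.natAbs) hi)⟩
    rw [Finset.mem_union, Finset.mem_image, Finset.mem_image]
    rcases le_total 0 i with h | h
    · exact Or.inl ⟨_, hJ, Int.natAbs_of_nonneg h⟩
    · exact Or.inr ⟨_, hJ, by omega⟩
  calc ∑ i ∈ I, f i.natAbs
      ≤ ∑ i ∈ J.image (fun i : ℕ => (i : ℤ)) ∪ J.image (fun i : ℕ => -(i : ℤ)), f i.natAbs :=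
        Finset.sum_le_sum_of_subset_of_nonneg hsub fun _ _ _ => hf _
    _ ≤ ∑ i ∈ J.image (fun i : ℕ => (i : ℤ)), f i.natAbs +
        ∑ i ∈ J.image (fun i : ℕ => -(i : ℤ)), f i.natAbs := by
        rw [← Finset.sum_union_inter]
        exact le_add_of_nonneg_right (Finset.sum_nonneg fun _ _ => hf _)
    _ = 2 * ∑ i ∈ J, f i := by
        rw [Finset.sum_image (fun _ _ _ _ h => by simpa using h),
          Finset.sum_image (fun _ _ _ _ h => by simpa using h)]
        simp [two_mul]

variable {n : ℕ}

/-- The representative in `(-1/2, 1/2]` of `s / n`. -/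
noncomputable def signedFrac (s : ZMod n) : ℝ := s.valMinAbs / n

/-- A heavy-tailed majorant of the powers of the eigenvalues. -/
noncomputable def tailWeight (k : ℕ) (s : ZMod n) : ℝ := 1 / (1 + 2 * k * signedFrac s ^ 2)

theorem tailWeight_nonneg (k : ℕ) (s : ZMod n) : 0 ≤ tailWeight k s := by
  unfold tailWeight; positivity

theorem tailWeight_zero (k : ℕ) : tailWeight k (0 : ZMod n) = 1 := by
  simp [tailWeight, signedFrac]

variable [NeZero n]

/-- With `φ = 2π * signedFrac s` in `[-π, π]`, the squared norm is `2 + 2 cos φ`, and `cos φ ≤ 1 - 2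
φ ^ 2 / π ^ 2`. -/
theorem norm_one_add_stdAddChar_le (s : ZMod n) :
    ‖1 + (ZMod.stdAddChar s : ℂ)‖ ≤ 2 * (1 - 2 * signedFrac s ^ 2) := by
  have hn : (0 : ℝ) < n := by exact_mod_cast NeZero.pos n
  have hb : |signedFrac s| ≤ 1 / 2 := by
    have := ZMod.valMinAbs_mem_Ioc s
    have h1 : (-n : ℝ) < s.valMinAbs * 2 := by exact_mod_cast this.1
    have h2 : (s.valMinAbs * 2 : ℝ) ≤ n := by exact_mod_cast this.2
    rw [signedFrac, abs_div, abs_of_pos hn, div_le_iff₀ hn, abs_le]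
    constructor <;> linarith
  have hψ : (ZMod.stdAddChar s : ℂ) = Complex.exp ((2 * Real.pi * signedFrac s : ℝ) * Complex.I) := by
    conv_lhs => rw [← ZMod.coe_valMinAbs s]
    rw [ZMod.stdAddChar_coe, signedFrac]
    congr 1
    push_cast
    ring
  have hsq : ‖1 + (ZMod.stdAddChar s : ℂ)‖ ^ 2 = 2 + 2 * Real.cos (2 * Real.pi * signedFrac s) := by
    rw [hψ, ← Complex.normSq_eq_norm_sq, Complex.normSq_apply]
    simp only [Complex.add_re, Complex.add_im, Complex.exp_ofReal_mul_I_re,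
      Complex.exp_ofReal_mul_I_im, Complex.one_re, Complex.one_im]
    nlinarith [Real.sin_sq_add_cos_sq (2 * Real.pi * signedFrac s)]
  have hcos := Real.cos_le_one_sub_mul_cos_sq (x := 2 * Real.pi * signedFrac s) (by
    rw [abs_mul, abs_of_pos (by positivity)]
    nlinarith [Real.pi_pos])
  have e : 2 / Real.pi ^ 2 * (2 * Real.pi * signedFrac s) ^ 2 = 8 * signedFrac s ^ 2 := by
    field_simp
    ring
  rw [e] at hcos
  have hs : signedFrac s ^ 2 ≤ 1 / 4 := by
    rw [← sq_abs]; nlinarith [abs_nonneg (signedFrac s)]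
  refine le_of_sq_le_sq ?_ (by linarith)
  rw [hsq]
  nlinarith [sq_nonneg (signedFrac s ^ 2)]

/-- The lazy half is shared equally between the two characters, so no eigenvalue can approach
modulus 1 by being close to `-1`. -/
theorem norm_walkEigenvalue_le (s t : ZMod n) :
    ‖walkEigenvalue s t‖ ≤ 1 - (signedFrac s ^ 2 + signedFrac t ^ 2) := by
  have e : walkEigenvalue s t =
      (1 + ZMod.stdAddChar s) / 4 + (1 + ZMod.stdAddChar t) / 4 := by
    rw [walkEigenvalue]; ring
  rw [e]
  refine (norm_add_le _ _).trans ?_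
  rw [norm_div, norm_div]
  have h4 : ‖(4 : ℂ)‖ = 4 := by simp
  rw [h4]
  linarith [norm_one_add_stdAddChar_le s, norm_one_add_stdAddChar_le t]

theorem signedFrac_eq_zero (s : ZMod n) : signedFrac s = 0 ↔ s = 0 := by
  have hn : (n : ℝ) ≠ 0 := by exact_mod_cast NeZero.ne n
  rw [signedFrac, div_eq_zero_iff, or_iff_left hn, Int.cast_eq_zero, ZMod.valMinAbs_eq_zero]

theorem norm_walkEigenvalue_le_one (s t : ZMod n) : ‖walkEigenvalue s t‖ ≤ 1 :=
  (norm_walkEigenvalue_le s t).trans (by nlinarith [sq_nonneg (signedFrac s), sq_nonneg (signedFrac t)])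

theorem norm_walkEigenvalue_lt_one {s t : ZMod n} (h : ¬ (s = 0 ∧ t = 0)) :
    ‖walkEigenvalue s t‖ < 1 := by
  refine (norm_walkEigenvalue_le s t).trans_lt ?_
  rw [← signedFrac_eq_zero, ← signedFrac_eq_zero, not_and_or] at h
  rcases h with h | h
  · nlinarith [sq_nonneg (signedFrac t), pow_pos (abs_pos.2 h) 2, sq_abs (signedFrac s)]
  · nlinarith [sq_nonneg (signedFrac s), pow_pos (abs_pos.2 h) 2, sq_abs (signedFrac t)]

theorem spectralSum_antitone (x y : ZMod n) : Antitone (spectralSum x y) := by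
  intro k l hkl
  refine Finset.sum_le_sum fun j _ => ?_
  exact pow_le_pow_of_le_one (norm_nonneg _) (norm_walkEigenvalue_le_one _ _) (by omega)

theorem tendsto_spectralSum (x y : ZMod n) :
    Tendsto (spectralSum x y) atTop (𝓝 0) := by
  have : Tendsto (fun k => ∑ j : ZMod n with ¬ (j * x = 0 ∧ j * y = 0),
      ‖walkEigenvalue (j * x) (j * y)‖ ^ (2 * k)) atTop
      (𝓝 (∑ j : ZMod n with ¬ (j * x = 0 ∧ j * y = 0), 0)) := by
    refine tendsto_finsetSum _ fun j hj => ?_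
    have h := norm_walkEigenvalue_lt_one (Finset.mem_filter.1 hj).2
    simp only [pow_mul]
    exact tendsto_pow_atTop_nhds_zero_of_lt_one (by positivity)
      (pow_lt_one₀ (norm_nonneg _) h two_ne_zero)
  rw [Finset.sum_const_zero] at this
  exact this

/-- From `1 - u ≤ exp (-u)` and `exp (-v) ≤ 1 / (1 + v)`. The majorant is a product, so its sum over
pairs of increments factors. -/
theorem norm_walkEigenvalue_pow_le (s t : ZMod n) (k : ℕ) :
    ‖walkEigenvalue s t‖ ^ (2 * k) ≤ tailWeight k s * tailWeight k t := by
  have hexp : ∀ u : ℝ, Real.exp (-(u ^ 2)) ^ (2 * k) ≤ 1 / (1 + 2 * k * u ^ 2) := by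
    intro u
    rw [← Real.exp_nat_mul, show ((2 * k : ℕ) : ℝ) * -(u ^ 2) = -(2 * k * u ^ 2) by push_cast; ring,
      Real.exp_neg, ← one_div]
    refine one_div_le_one_div_of_le (by positivity) ?_
    linarith [Real.add_one_le_exp (2 * k * u ^ 2)]
  have h1 : ‖walkEigenvalue s t‖ ≤
      Real.exp (-(signedFrac s ^ 2)) * Real.exp (-(signedFrac t ^ 2)) := by
    rw [← Real.exp_add]
    refine (norm_walkEigenvalue_le s t).trans ?_
    linarith [Real.add_one_le_exp (-(signedFrac s ^ 2) + -(signedFrac t ^ 2))]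
  calc ‖walkEigenvalue s t‖ ^ (2 * k)
      ≤ (Real.exp (-(signedFrac s ^ 2)) * Real.exp (-(signedFrac t ^ 2))) ^ (2 * k) := by gcongr
    _ = Real.exp (-(signedFrac s ^ 2)) ^ (2 * k) * Real.exp (-(signedFrac t ^ 2)) ^ (2 * k) :=
        mul_pow _ _ _
    _ ≤ tailWeight k s * tailWeight k t := by
        unfold tailWeight
        exact mul_le_mul (hexp _) (hexp _) (by positivity) (by positivity)

/-- For a fixed multiplier `j`, the average of `tailWeight k (j * x)` over `x`. -/
theorem exists_sum_tailWeight_eq (j : ZMod n) {k : ℕ} (hk : 0 < k) :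
    ∃ θ : ℝ, 0 ≤ θ ∧ ∑ x, tailWeight k (j * x) =
      (Finset.univ.filter fun x : ZMod n => j * x = 0).card * (1 + θ) ∧
      ((Finset.univ.filter fun x : ZMod n => j * x = 0).card : ℝ) ^ 2 * (2 * θ + θ ^ 2) ≤
        12 * n ^ 2 / k := by
  classical
  set f : ZMod n →+ ZMod n := AddMonoidHom.mulLeft j
  set N := (Finset.univ.filter fun x : ZMod n => j * x = 0).card with hN
  set R := (Finset.univ : Finset (ZMod n)).image f with hR
  have hRmem : ∀ {s}, s ∈ R ↔ s ∈ Set.range f := by intro s; simp [hR]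
  have hfib : ∀ s ∈ R, (Finset.univ.filter fun x : ZMod n => f x = s).card = N := by
    intro s hs
    exact AddMonoidHom.card_fiber_eq_of_mem_range f (hRmem.1 hs) ⟨0, map_zero f⟩
  have hcard : n = N * R.card := by
    have := Finset.card_eq_sum_card_image f (Finset.univ : Finset (ZMod n))
    rw [Finset.sum_congr rfl hfib, Finset.sum_const, smul_eq_mul, Finset.card_univ,
      ZMod.card] at this
    exact this.trans (mul_comm _ _)
  have hn0 : 0 < n := NeZero.pos n
  have hNpos : 0 < N := Nat.pos_of_ne_zero fun h => by rw [h, zero_mul] at hcard; omega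
  have hmpos : 0 < R.card := Nat.pos_of_ne_zero fun h => by rw [h, mul_zero] at hcard; omega
  set m := R.card with hm
  have h0R : (0 : ZMod n) ∈ R := hRmem.2 ⟨0, map_zero f⟩
  -- Every value of `x ↦ j * x` is taken `N` times; `θ` collects the nonzero values.
  refine ⟨∑ s ∈ R.erase 0, tailWeight k s, Finset.sum_nonneg fun _ _ => tailWeight_nonneg _ _,
    ?_, ?_⟩
  · change ∑ x, tailWeight k (f x) = _
    rw [Finset.sum_comp (tailWeight k) f, ← hR,
      Finset.sum_congr rfl fun s hs => by rw [hfib s hs], ← Finset.smul_sum,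
      ← Finset.add_sum_erase R _ h0R, tailWeight_zero, nsmul_eq_mul]
  -- The image has order `m = n / N`, hence consists of multiples `N * i`, with signed fraction `i /
  -- m`. The tail sum is thus over distinct nonzero integers `i`.
  · have hdvd : ∀ s ∈ R, (N : ℤ) ∣ s.valMinAbs := by
      intro s hs
      obtain ⟨x, rfl⟩ := hRmem.1 hs
      have h1 : m • f x = 0 := by
        have hc : Nat.card f.range = m := by
          rw [hm, ← Nat.card_eq_finsetCard]
          exact Nat.card_congr (Equiv.subtypeEquivRight fun s => by
            rw [hRmem]; rfl)
        have := card_nsmul_eq_zero' (x := (⟨f x, x, rfl⟩ : f.range))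
        rw [hc] at this
        exact congrArg Subtype.val this
      have h2 : (((m : ℤ) * (f x).valMinAbs : ℤ) : ZMod n) = 0 := by
        rw [Int.cast_mul, ZMod.coe_valMinAbs, Int.cast_natCast, ← nsmul_eq_mul, h1]
      rw [ZMod.intCast_zmod_eq_zero_iff_dvd] at h2
      have h3 : ((m : ℤ) * N) ∣ m * (f x).valMinAbs := by
        have : ((m : ℤ) * N) = (n : ℤ) := by rw [mul_comm]; exact_mod_cast hcard.symm
        rw [this]; exact h2
      exact (mul_dvd_mul_iff_left (by exact_mod_cast hmpos.ne')).1 h3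
    set b : ℝ := Real.sqrt (2 * k) / m with hb
    have hkR : (0 : ℝ) < k := by exact_mod_cast hk
    have hmR : (0 : ℝ) < m := by exact_mod_cast hmpos
    have hNR : (0 : ℝ) < N := by exact_mod_cast hNpos
    have hbpos : 0 < b := by positivity
    have hb2 : b ^ 2 = 2 * k / m ^ 2 := by
      rw [hb, div_pow, Real.sq_sqrt (by positivity)]
    have hnR : (n : ℝ) = N * m := by exact_mod_cast hcard
    have hsum : ∑ s ∈ R.erase 0, tailWeight k s =
        ∑ i ∈ (R.erase 0).image (fun s => s.valMinAbs / (N : ℤ)),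
          1 / (1 + b ^ 2 * (i.natAbs : ℝ) ^ 2) := by
      rw [Finset.sum_image]
      · refine Finset.sum_congr rfl fun s hs => ?_
        obtain ⟨i, hi⟩ := hdvd s (Finset.mem_of_mem_erase hs)
        rw [tailWeight, signedFrac, hi, Int.mul_ediv_cancel_left _ (by exact_mod_cast hNpos.ne'),
          hnR, hb2, Nat.cast_natAbs, Int.cast_abs, sq_abs]
        push_cast
        congr 2
        field_simp
      · intro s hs t ht hst
        apply ZMod.injective_valMinAbs
        rw [← Int.mul_ediv_cancel' (hdvd s (Finset.mem_of_mem_erase hs)),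
          ← Int.mul_ediv_cancel' (hdvd t (Finset.mem_of_mem_erase ht))]
        exact congrArg _ hst
    obtain ⟨M, hM⟩ := sum_int_le_two_mul_sum_Ioo (fun i : ℕ => 1 / (1 + b ^ 2 * (i : ℝ) ^ 2))
      (fun i => by positivity) ((R.erase 0).image (fun s => s.valMinAbs / (N : ℤ))) (by
        rw [Finset.mem_image]
        rintro ⟨s, hs, h⟩
        have := Int.mul_ediv_cancel' (hdvd s (Finset.mem_of_mem_erase hs))
        rw [h, mul_zero] at this
        exact Finset.ne_of_mem_erase hs ((ZMod.valMinAbs_eq_zero s).1 this.symm))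
    rw [← hsum] at hM
    set θ := ∑ s ∈ R.erase 0, tailWeight k s
    have hθ0 : 0 ≤ θ := Finset.sum_nonneg fun _ _ => tailWeight_nonneg _ _
    have h1 := sum_Ioo_one_div_one_add_sq_le b hbpos M
    have h2 := sum_Ioo_one_div_one_add_sq_le' b hbpos M
    have hθ1 : θ ≤ 4 / b := by
      have : 4 / b = 2 * (2 / b) := by ring
      linarith
    have hθ2 : θ ≤ 4 / b ^ 2 := by
      have : 4 / b ^ 2 = 2 * (2 / b ^ 2) := by ring
      linarith
    have hθ3 : θ ^ 2 ≤ 16 / b ^ 2 := by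
      have : (4 / b) ^ 2 = 16 / b ^ 2 := by ring
      rw [← this]; gcongr
    have hfin : 2 * θ + θ ^ 2 ≤ 24 / b ^ 2 := by
      have : 24 / b ^ 2 = 2 * (4 / b ^ 2) + 16 / b ^ 2 := by ring
      linarith
    calc (N : ℝ) ^ 2 * (2 * θ + θ ^ 2) ≤ (N : ℝ) ^ 2 * (24 / b ^ 2) := by gcongr
      _ = 12 * (n : ℝ) ^ 2 / k := by
        rw [hb2, hnR]; field_simp; ring

/-- The second moment bound: the spectral sum is small for most pairs of increments. -/
theorem sum_spectralSum_le {k : ℕ} (hk : 0 < k) :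
    ∑ x : ZMod n, ∑ y : ZMod n, spectralSum x y k ≤ 12 * n ^ 3 / k := by
  have hj : ∀ j : ZMod n, ∑ x : ZMod n, ∑ y : ZMod n,
      (if ¬ (j * x = 0 ∧ j * y = 0) then ‖walkEigenvalue (j * x) (j * y)‖ ^ (2 * k) else 0) ≤
        12 * n ^ 2 / k := by
    intro j
    obtain ⟨θ, -, hS, hθ⟩ := exists_sum_tailWeight_eq j hk
    -- Subtracting the pairs where the character is trivial turns the factored total `N² (1 + θ)²`
    -- into `N² (2θ + θ²)`, the quantity bounded in `hθ`.
    have hpt : ∀ x y : ZMod n,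
        (if ¬ (j * x = 0 ∧ j * y = 0) then ‖walkEigenvalue (j * x) (j * y)‖ ^ (2 * k) else 0) ≤
        tailWeight k (j * x) * tailWeight k (j * y) -
          (if j * x = 0 then 1 else 0) * (if j * y = 0 then 1 else 0) := by
      intro x y
      by_cases h : j * x = 0 ∧ j * y = 0
      · simp [h.1, h.2, tailWeight_zero]
      · rw [if_pos h]
        have h0 : ((if j * x = 0 then 1 else 0) * (if j * y = 0 then 1 else 0) : ℝ) = 0 := by
          rw [not_and_or] at h
          rcases h with h | h <;> simp [h]
        rw [h0, sub_zero]
        exact norm_walkEigenvalue_pow_le _ _ _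
    refine (Finset.sum_le_sum fun x _ => Finset.sum_le_sum fun y _ => hpt x y).trans ?_
    simp only [Finset.sum_sub_distrib]
    rw [← Finset.sum_mul_sum, ← Finset.sum_mul_sum, hS, Finset.sum_boole]
    refine le_trans (le_of_eq ?_) hθ
    ring
  have hswap : ∑ x : ZMod n, ∑ y : ZMod n, spectralSum x y k = ∑ j : ZMod n, ∑ x : ZMod n,
      ∑ y : ZMod n,
      (if ¬ (j * x = 0 ∧ j * y = 0) then ‖walkEigenvalue (j * x) (j * y)‖ ^ (2 * k) else 0) := by
    simp only [spectralSum, Finset.sum_filter]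
    refine (Finset.sum_congr rfl fun x _ => Finset.sum_comm).trans Finset.sum_comm
  rw [hswap]
  refine (Finset.sum_le_sum fun j _ => hj j).trans (le_of_eq ?_)
  rw [Finset.sum_const, Finset.card_univ, ZMod.card, nsmul_eq_mul]
  ring

/-- Few pairs generate a subgroup of large index. -/
theorem card_filter_card_closure_le {M : ℕ} (hM : 0 < M) :
    ((Finset.univ.filter fun xy : ZMod n × ZMod n =>
      M * Nat.card (AddSubgroup.closure {xy.1, xy.2}) ≤ n).card : ℝ) ≤ 2 / M * n ^ 2 := by
  classical
  have hn : 0 < n := NeZero.pos n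
  set T : ℕ → Finset (ZMod n) := fun d => Finset.univ.filter fun a : ZMod n => d • a = 0
  -- A subgroup of index `m` lies in the `n / m`-torsion, which in a cyclic group has at most `n /
  -- m` elements. So at most `(n / m) ^ 2` pairs generate a subgroup of index `m`, and these counts
  -- are summed over `m ≥ M`.
  have hsub : (Finset.univ.filter fun xy : ZMod n × ZMod n =>
      M * Nat.card (AddSubgroup.closure {xy.1, xy.2}) ≤ n) ⊆
      ((Finset.Ioo (M - 1) (n + 1)).filter (· ∣ n)).biUnion fun m => T (n / m) ×ˢ T (n / m) := by
    rintro ⟨x, y⟩ hxy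
    simp only [Finset.mem_filter, Finset.mem_univ, true_and] at hxy
    set H := AddSubgroup.closure {x, y}
    have hmul := H.card_mul_index
    rw [Nat.card_zmod] at hmul
    have hpos : 0 < Nat.card H := Nat.card_pos
    have hidx : n / H.index = Nat.card H := by
      exact Nat.div_eq_of_eq_mul_left
        (Nat.pos_of_ne_zero fun h => by rw [h, mul_zero] at hmul; omega) hmul.symm
    have hT : ∀ z ∈ H, z ∈ T (n / H.index) := by
      intro z hz
      rw [hidx]
      have := card_nsmul_eq_zero' (x := (⟨z, hz⟩ : H))
      exact Finset.mem_filter.2 ⟨Finset.mem_univ _, congrArg Subtype.val this⟩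
    refine Finset.mem_biUnion.2 ⟨H.index, ?_, Finset.mem_product.2
      ⟨hT x (AddSubgroup.subset_closure (by simp)), hT y (AddSubgroup.subset_closure (by simp))⟩⟩
    refine Finset.mem_filter.2 ⟨Finset.mem_Ioo.2 ⟨?_, ?_⟩, ⟨_, by rw [mul_comm]; exact hmul.symm⟩⟩
    · have : M ≤ H.index := by
        by_contra! h
        have := Nat.mul_lt_mul_of_pos_right h hpos
        rw [mul_comm H.index, hmul] at this
        omega
      omega
    · have := Nat.le_of_dvd hn ⟨_, by rw [mul_comm]; exact hmul.symm⟩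
      omega
  have hT : ∀ m ∈ (Finset.Ioo (M - 1) (n + 1)).filter (· ∣ n),
      ((T (n / m) ×ˢ T (n / m)).card : ℝ) ≤ n ^ 2 * ((m : ℝ) ^ 2)⁻¹ := by
    intro m hm
    have hmn := (Finset.mem_filter.1 hm).2
    have hm0 : 0 < m := Nat.pos_of_dvd_of_pos hmn hn
    have h1 : (T (n / m)).card ≤ n / m :=
      IsAddCyclic.card_nsmul_eq_zero_le (Nat.div_pos (Nat.le_of_dvd hn hmn) hm0)
    have h2 : ((T (n / m)).card : ℝ) ≤ n / m := by
      rw [← Nat.cast_div hmn (by exact_mod_cast hm0.ne')]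
      exact_mod_cast h1
    rw [Finset.card_product, Nat.cast_mul, ← sq, ← div_eq_mul_inv, ← div_pow]
    gcongr
  calc _ ≤ ((((Finset.Ioo (M - 1) (n + 1)).filter (· ∣ n)).biUnion
        fun m => T (n / m) ×ˢ T (n / m)).card : ℝ) := by
        exact_mod_cast Finset.card_le_card hsub
    _ ≤ ∑ m ∈ (Finset.Ioo (M - 1) (n + 1)).filter (· ∣ n), ((T (n / m) ×ˢ T (n / m)).card : ℝ) := by
        exact_mod_cast Finset.card_biUnion_le
    _ ≤ ∑ m ∈ (Finset.Ioo (M - 1) (n + 1)).filter (· ∣ n), n ^ 2 * ((m : ℝ) ^ 2)⁻¹ :=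
        Finset.sum_le_sum hT
    _ ≤ ∑ m ∈ Finset.Ioo (M - 1) (n + 1), n ^ 2 * ((m : ℝ) ^ 2)⁻¹ :=
        Finset.sum_le_sum_of_subset_of_nonneg (Finset.filter_subset _ _) fun _ _ _ => by positivity
    _ ≤ n ^ 2 * (2 / M) := by
        rw [← Finset.mul_sum]
        have := sum_Ioo_inv_sq_le (α := ℝ) (M - 1) (n + 1)
        rw [Nat.cast_sub hM, Nat.cast_one, sub_add_cancel] at this
        gcongr
    _ = 2 / M * n ^ 2 := by ring

end Spectral

/-! ### Step counts and the lower bound -/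

section Concentration

/-- The expectation of `f i j`, where `i` and `j` count the steps of the first two kinds among `k`
independent steps of three kinds with probabilities `1/4`, `1/4`, `1/2`. -/
noncomputable def stepCountMean : ℕ → (ℤ → ℤ → ℝ) → ℝ
  | 0, f => f 0 0
  | k + 1, f => stepCountMean k fun i j => f (i + 1) j / 4 + f i (j + 1) / 4 + f i j / 2

theorem stepCountMean_mono (k : ℕ) : ∀ {f g : ℤ → ℤ → ℝ}, (∀ i j, f i j ≤ g i j) →
    stepCountMean k f ≤ stepCountMean k g := by
  induction k with
  | zero => exact fun h => h 0 0
  | succ k ih =>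
    intro f g h
    refine ih fun i j => ?_
    linarith [h (i + 1) j, h i (j + 1), h i j]

theorem stepCountMean_affine (k : ℕ) (a b : ℝ) : ∀ f : ℤ → ℤ → ℝ,
    stepCountMean k (fun i j => a * f i j + b) = a * stepCountMean k f + b := by
  induction k with
  | zero => exact fun f => rfl
  | succ k ih =>
    intro f
    simp only [stepCountMean]
    rw [← ih]
    congr 1
    ext i j
    ring

/-- In one step `4 i - k` changes by 3 with probability 1/4 and by -1 otherwise: mean 0, variance 3.
The two coordinates together give 6 per step. -/
theorem stepCountMean_sq_dev (k : ℕ) :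
    stepCountMean k (fun i j => (4 * (i : ℝ) - k) ^ 2 + (4 * (j : ℝ) - k) ^ 2) = 6 * k := by
  induction k with
  | zero => simp [stepCountMean]
  | succ k ih =>
    have e : (fun i j : ℤ => ((4 * ((i + 1 : ℤ) : ℝ) - (k + 1 : ℕ)) ^ 2 +
          (4 * (j : ℝ) - (k + 1 : ℕ)) ^ 2) / 4 +
        ((4 * (i : ℝ) - (k + 1 : ℕ)) ^ 2 + (4 * ((j + 1 : ℤ) : ℝ) - (k + 1 : ℕ)) ^ 2) / 4 +
        ((4 * (i : ℝ) - (k + 1 : ℕ)) ^ 2 + (4 * (j : ℝ) - (k + 1 : ℕ)) ^ 2) / 2) =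
        fun i j : ℤ => 1 * ((4 * (i : ℝ) - k) ^ 2 + (4 * (j : ℝ) - k) ^ 2) + 6 := by
      ext i j
      push_cast
      ring
    rw [stepCountMean, e, stepCountMean_affine, ih]
    push_cast
    ring

variable {n : ℕ}

variable [NeZero n]

/-- Commutativity: the position depends only on how often each increment was used, not on the order.
-/
theorem sum_walkWeight_mul (α β γ : ZMod n) (k : ℕ) : ∀ F : ZMod n → ℝ,
    ∑ t, walkWeight α β γ k t * F t =
      stepCountMean k fun i j => F (i * α + j * β + (k - i - j) * γ) := by
  induction k with
  | zero => intro F; simp [walkWeight, stepCountMean]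
  | succ k ih =>
    intro F
    have shift : ∀ δ : ZMod n, ∑ t, walkWeight α β γ k (t - δ) * F t =
        ∑ t, walkWeight α β γ k t * F (t + δ) := by
      intro δ
      rw [← Equiv.sum_comp (Equiv.addRight δ)]
      exact Finset.sum_congr rfl fun t _ => by simp
    have h : ∑ t, walkWeight α β γ (k + 1) t * F t =
        ∑ t, walkWeight α β γ k t * (F (t + α) / 4 + F (t + β) / 4 + F (t + γ) / 2) := by
      have e1 : ∑ t, walkWeight α β γ (k + 1) t * F t =
          (∑ t, walkWeight α β γ k (t - α) * F t) / 4 +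
          (∑ t, walkWeight α β γ k (t - β) * F t) / 4 +
          (∑ t, walkWeight α β γ k (t - γ) * F t) / 2 := by
        rw [Finset.sum_div, Finset.sum_div, Finset.sum_div, ← Finset.sum_add_distrib,
          ← Finset.sum_add_distrib]
        refine Finset.sum_congr rfl fun t _ => ?_
        simp only [walkWeight]
        ring
      rw [e1, shift, shift, shift, Finset.sum_div, Finset.sum_div, Finset.sum_div,
        ← Finset.sum_add_distrib, ← Finset.sum_add_distrib]
      refine Finset.sum_congr rfl fun t _ => ?_
      ring
    rw [h, ih, stepCountMean]
    congr 1
    ext i j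
    congr 1
    · congr 1
      · congr 2
        push_cast
        ring
      · congr 2
        push_cast
        ring
    · congr 2
      push_cast
      ring

theorem sum_walkWeight (α β γ : ZMod n) (k : ℕ) : ∑ t, walkWeight α β γ k t = 1 := by
  have h := sum_walkWeight_mul α β γ k fun _ => 1
  have h2 := stepCountMean_affine k 0 1 fun _ _ => 0
  simp only [mul_one, zero_mul, zero_add] at h h2
  rw [h, h2]

theorem card_Icc_ceil_floor_le (k : ℕ) {r : ℝ} (hr : 0 ≤ r) :
    ((Finset.Icc ⌈((k : ℝ) - r) / 4⌉ ⌊((k : ℝ) + r) / 4⌋).card : ℝ) ≤ r / 2 + 1 := by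
  rw [Int.card_Icc]
  have h1 := Int.le_ceil (((k : ℝ) - r) / 4)
  have h2 := Int.floor_le (((k : ℝ) + r) / 4)
  rcases le_total 0 (⌊((k : ℝ) + r) / 4⌋ + 1 - ⌈((k : ℝ) - r) / 4⌉) with h | h
  · have : (((⌊((k : ℝ) + r) / 4⌋ + 1 - ⌈((k : ℝ) - r) / 4⌉).toNat : ℤ) : ℝ) =
        ⌊((k : ℝ) + r) / 4⌋ + 1 - ⌈((k : ℝ) - r) / 4⌉ := by
      rw [Int.toNat_of_nonneg h]; push_cast; ring
    rw [Int.cast_natCast] at this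
    rw [this]
    linarith
  · rw [Int.toNat_of_nonpos h]
    push_cast
    positivity

/-- The walk is concentrated on a set of size linear in the number of steps. -/
theorem exists_small_set_walkWeight (α β γ : ZMod n) (k : ℕ) {K : ℝ} (hK : 0 < K) :
    ∃ S : Finset (ZMod n), (S.card : ℝ) ≤ 3 * K * k + 3 ∧
      1 - 1 / K ≤ ∑ t ∈ S, walkWeight α β γ k t := by
  classical
  -- Chebyshev's radius squared: the mean square deviation is `6 * k`. The `+ 1` keeps `R` positive
  -- at `k = 0`.
  set R : ℝ := 6 * k * K + 1 with hR
  have hRpos : 0 < R := by positivity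
  set r := Real.sqrt R
  have hr : r ^ 2 = R := Real.sq_sqrt hRpos.le
  set I := Finset.Icc ⌈((k : ℝ) - r) / 4⌉ ⌊((k : ℝ) + r) / 4⌋
  have hI : ((I.card : ℕ) : ℝ) ≤ r / 2 + 1 := card_Icc_ceil_floor_le k (Real.sqrt_nonneg R)
  set pos : ℤ × ℤ → ZMod n := fun ij => ij.1 * α + ij.2 * β + (k - ij.1 - ij.2) * γ
  refine ⟨(I ×ˢ I).image pos, ?_, ?_⟩
  · calc (((I ×ˢ I).image pos).card : ℝ) ≤ (I ×ˢ I).card := by exact_mod_cast Finset.card_image_le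
      _ = (I.card : ℝ) ^ 2 := by rw [Finset.card_product]; push_cast; ring
      _ ≤ (r / 2 + 1) ^ 2 := by gcongr
      _ ≤ 3 * K * k + 3 := by nlinarith [sq_nonneg (r / 2 - 1)]
  · have h1 : ∑ t ∈ (I ×ˢ I).image pos, walkWeight α β γ k t =
        ∑ t, walkWeight α β γ k t * (if t ∈ (I ×ˢ I).image pos then 1 else 0) := by
      simp only [mul_ite, mul_one, mul_zero, Finset.sum_ite_mem, Finset.univ_inter]
    rw [h1, sum_walkWeight_mul]
    -- Chebyshev's inequality pointwise: the indicator of the box dominates `1 - Q / R`, with `Q`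
    -- the squared deviation.
    have h2 : ∀ i j : ℤ, -(1 / R) * ((4 * (i : ℝ) - k) ^ 2 + (4 * (j : ℝ) - k) ^ 2) + 1 ≤
        (if (i * α + j * β + (k - i - j) * γ : ZMod n) ∈ (I ×ˢ I).image pos then 1 else 0) := by
      intro i j
      by_cases hq : (4 * (i : ℝ) - k) ^ 2 + (4 * (j : ℝ) - k) ^ 2 ≤ R
      · have mem : ∀ l : ℤ, (4 * (l : ℝ) - k) ^ 2 ≤ R → l ∈ I := by
          intro l hl
          have := abs_le.1 (Real.abs_le_sqrt hl)
          refine Finset.mem_Icc.2 ⟨Int.ceil_le.2 ?_, Int.le_floor.2 ?_⟩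
          · linarith [this.1]
          · linarith [this.2]
        rw [if_pos (Finset.mem_image.2 ⟨(i, j), Finset.mem_product.2
          ⟨mem i (by nlinarith), mem j (by nlinarith)⟩, rfl⟩)]
        have : 0 ≤ 1 / R * ((4 * (i : ℝ) - k) ^ 2 + (4 * (j : ℝ) - k) ^ 2) := by positivity
        linarith
      · have h : 1 ≤ 1 / R * ((4 * (i : ℝ) - k) ^ 2 + (4 * (j : ℝ) - k) ^ 2) := by
          rw [one_div_mul_eq_div, le_div_iff₀ hRpos]
          linarith
        have : (0 : ℝ) ≤ if (i * α + j * β + (k - i - j) * γ : ZMod n) ∈ (I ×ˢ I).image pos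
          then 1 else 0 := by split_ifs <;> norm_num
        linarith
    refine le_trans ?_ (stepCountMean_mono k h2)
    rw [stepCountMean_affine, stepCountMean_sq_dev]
    have : 1 / R * (6 * k) ≤ 1 / K := by
      rw [one_div_mul_eq_div, div_le_div_iff₀ hRpos hK]
      linarith
    linarith

/-- The lower bound lemma: the walk is far from any uniform distribution on a large coset. -/
theorem le_half_sum_abs_sub_cosetWeight (α β γ g : ZMod n) (H : AddSubgroup (ZMod n)) (k : ℕ)
    {K : ℝ} (hK : 0 < K) :
    1 - 1 / K - (3 * K * k + 3) / Nat.card H ≤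
      (1 / 2) * ∑ t, |walkWeight α β γ k t - cosetWeight H g t| := by
  obtain ⟨S, hS, hw⟩ := exists_small_set_walkWeight α β γ k hK
  have hHpos : (0 : ℝ) < Nat.card H := by exact_mod_cast Nat.card_pos
  set f : ZMod n → ℝ := fun t => walkWeight α β γ k t - cosetWeight H g t
  have hu : ∑ t ∈ S, cosetWeight H g t ≤ (3 * K * k + 3) / Nat.card H := by
    calc ∑ t ∈ S, cosetWeight H g t ≤ ∑ t ∈ S, (Nat.card H : ℝ)⁻¹ := by
          refine Finset.sum_le_sum fun t _ => ?_
          unfold cosetWeight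
          split_ifs
          · exact le_rfl
          · positivity
      _ = S.card / Nat.card H := by rw [Finset.sum_const, nsmul_eq_mul, div_eq_mul_inv]
      _ ≤ _ := by gcongr
  have hf : ∑ t ∈ S, f t = ∑ t ∈ S, walkWeight α β γ k t - ∑ t ∈ S, cosetWeight H g t :=
    Finset.sum_sub_distrib _ _
  -- The difference of two probability weights has total 0, so `S` and its complement each
  -- contribute at least its mass on `S` to the `L¹` norm.
  have h0 : ∑ t ∈ S, f t + ∑ t ∈ Sᶜ, f t = 0 := by
    rw [Finset.sum_add_sum_compl, Finset.sum_sub_distrib, sum_walkWeight, sum_cosetWeight, sub_self]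
  have habs : ∑ t, |f t| = ∑ t ∈ S, |f t| + ∑ t ∈ Sᶜ, |f t| :=
    (Finset.sum_add_sum_compl S _).symm
  have h1 : ∑ t ∈ S, f t ≤ ∑ t ∈ S, |f t| := Finset.sum_le_sum fun _ _ => le_abs_self _
  have h2 : -∑ t ∈ Sᶜ, f t ≤ ∑ t ∈ Sᶜ, |f t| := by
    rw [← Finset.sum_neg_distrib]
    exact Finset.sum_le_sum fun _ _ => neg_le_abs _
  rw [habs]
  linarith

end Concentration

/-! ### Bracket identities in `sl₂` -/

section Bracket

variable {p : ℕ}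

theorem sl2_apply_one_one (A : SL2Lie p) : A.1 1 1 = -A.1 0 0 := by
  have h : A.1.trace = 0 := A.2
  rw [Matrix.trace_fin_two] at h
  linear_combination h

theorem sl2_ext {A B : SL2Lie p} (h0 : A.1 0 0 = B.1 0 0) (h1 : A.1 0 1 = B.1 0 1)
    (h2 : A.1 1 0 = B.1 1 0) : A = B := by
  apply Subtype.ext
  ext i j
  fin_cases i <;> fin_cases j
  · exact h0
  · exact h1
  · exact h2
  · exact (sl2_apply_one_one A).trans ((congrArg _ h0).trans (sl2_apply_one_one B).symm)

theorem sl2_smul_apply (t : ZMod p) (A : SL2Lie p) (i j : Fin 2) :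
    (t • A).1 i j = t * A.1 i j := rfl

theorem sl2_bracket_zero_zero (A B : SL2Lie p) :
    (⁅A, B⁆ : SL2Lie p).1 0 0 = A.1 0 1 * B.1 1 0 - B.1 0 1 * A.1 1 0 := by
  rw [LieAlgebra.SpecialLinear.sl_bracket, Matrix.sub_apply, Matrix.mul_apply, Matrix.mul_apply,
    Fin.sum_univ_two, Fin.sum_univ_two]
  ring

theorem sl2_bracket_zero_one (A B : SL2Lie p) :
    (⁅A, B⁆ : SL2Lie p).1 0 1 = 2 * (A.1 0 0 * B.1 0 1 - B.1 0 0 * A.1 0 1) := by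
  rw [LieAlgebra.SpecialLinear.sl_bracket, Matrix.sub_apply, Matrix.mul_apply, Matrix.mul_apply,
    Fin.sum_univ_two, Fin.sum_univ_two, sl2_apply_one_one A, sl2_apply_one_one B]
  ring

theorem sl2_bracket_one_zero (A B : SL2Lie p) :
    (⁅A, B⁆ : SL2Lie p).1 1 0 = 2 * (A.1 1 0 * B.1 0 0 - B.1 1 0 * A.1 0 0) := by
  rw [LieAlgebra.SpecialLinear.sl_bracket, Matrix.sub_apply, Matrix.mul_apply, Matrix.mul_apply,
    Fin.sum_univ_two, Fin.sum_univ_two, sl2_apply_one_one A, sl2_apply_one_one B]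
  ring

/-- The invariant form `2 * tr (A * B)` on trace-zero `2 × 2` matrices. -/
def bracketForm (A B : SL2Lie p) : ZMod p :=
  4 * (A.1 0 0 * B.1 0 0) + 2 * (A.1 0 1 * B.1 1 0 + A.1 1 0 * B.1 0 1)

theorem bracketForm_comm (A B : SL2Lie p) : bracketForm A B = bracketForm B A := by
  unfold bracketForm; ring

/-- This is the vector triple product `C × (D × V) = (C·V) D - (C·D) V` in disguise: `⁅A, B⁆` is
orthogonal to `A` and `B`, so only the multiple of `V` survives. -/
theorem double_bracket_smul (A B : SL2Lie p) (b c : Bool) (t : ZMod p) :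
    ⁅cond c A B, ⁅cond b A B, t • ⁅A, B⁆⁆⁆ =
      (bracketForm (cond b A B) (cond c A B) * t) • ⁅A, B⁆ := by
  apply sl2_ext <;> cases b <;> cases c <;>
  simp only [cond_true, cond_false, sl2_bracket_zero_zero, sl2_bracket_zero_one,
    sl2_bracket_one_zero, bracketForm, sl2_smul_apply] <;>
  ring

/-- Lagrange's identity: the Gram determinant is a quadratic form in the entries of `⁅A, B⁆`. -/
theorem bracketForm_mul_self_of_bracket_eq_zero (A B : SL2Lie p) (h : ⁅A, B⁆ = 0) :
    bracketForm A A * bracketForm B B = bracketForm A B ^ 2 := by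
  have h0 := sl2_bracket_zero_zero A B
  have h1 := sl2_bracket_zero_one A B
  have h2 := sl2_bracket_one_zero A B
  rw [h] at h0 h1 h2
  change 0 = _ at h0
  change 0 = _ at h1
  change 0 = _ at h2
  unfold bracketForm
  have h3 : (2 * (A.1 0 0 * B.1 0 1 - B.1 0 0 * A.1 0 1)) *
      (2 * (A.1 1 0 * B.1 0 0 - B.1 1 0 * A.1 0 0)) = 0 := by rw [← h1, zero_mul]
  have h4 : (A.1 0 1 * B.1 1 0 - B.1 0 1 * A.1 1 0) ^ 2 = 0 := by rw [← h0]; ring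
  linear_combination (-4) * h3 - 4 * h4

end Bracket

/-! ### From the random bracket to the logarithmic walk -/

section Law

/-- Uniform choice from `{A, B}` amounts to flipping a coin. -/
theorem map_cond_uniformOfFintype_bool {α : Type*} [DecidableEq α] {A B : α} (hAB : A ≠ B)
    (h : ({A, B} : Finset α).Nonempty) :
    PMF.uniformOfFinset {A, B} h = (PMF.uniformOfFintype Bool).map fun b => cond b A B := by
  ext X
  rw [PMF.uniformOfFinset_apply, PMF.map_apply, tsum_bool, Finset.card_pair hAB]
  simp only [cond_true, cond_false, PMF.uniformOfFintype_apply, Fintype.card_bool]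
  by_cases hA : X = A
  · subst hA
    simp [hAB]
  · by_cases hB : X = B
    · subst hB
      simp [hA]
    · simp [hA, hB]

variable {n : ℕ}

/-- The increment of the logarithm of the walk caused by two successive coin flips. -/
def pairIncrement (α β γ : ZMod n) (b c : Bool) : ZMod n :=
  if b = c then cond b α β else γ

/-- The logarithmic walk as a sequence of distributions on `ZMod n`. -/
noncomputable def logWalk (α β γ : ZMod n) : ℕ → PMF (ZMod n)
  | 0 => PMF.pure 0
  | k + 1 => (PMF.uniformOfFintype Bool).bind fun b => (PMF.uniformOfFintype Bool).bind fun c =>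
      (logWalk α β γ k).map fun t => t + pairIncrement α β γ b c

theorem PMF.map_apply_of_injective {α β : Type*} (μ : PMF α) {f : α → β}
    (hf : Function.Injective f) (a : α) : (μ.map f) (f a) = μ a := by
  rw [PMF.map_apply, tsum_eq_single a]
  · simp
  · intro b hb
    rw [if_neg fun h => hb (hf h.symm)]

theorem toReal_logWalk (α β γ : ZMod n) (k : ℕ) : ∀ t,
    (logWalk α β γ k t).toReal = walkWeight α β γ k t := by
  induction k with
  | zero =>
    intro t
    simp only [logWalk, walkWeight, PMF.pure_apply]
    split_ifs <;> simp
  | succ k ih =>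
    intro t
    have hmap : ∀ δ : ZMod n, ((logWalk α β γ k).map fun s => s + δ) t =
        logWalk α β γ k (t - δ) := by
      intro δ
      conv_lhs => rw [← sub_add_cancel t δ]
      exact PMF.map_apply_of_injective _ (add_left_injective δ) _
    have hfin : ∀ s, logWalk α β γ k s ≠ ⊤ := fun s => PMF.apply_ne_top _ _
    simp only [logWalk, walkWeight, PMF.bind_apply, tsum_bool, hmap, PMF.uniformOfFintype_apply,
      Fintype.card_bool, ← ih, pairIncrement]
    have h2 : ((2 : ℕ) : ENNReal)⁻¹ ≠ ⊤ := by simp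
    have hm : ∀ {x : ENNReal}, x ≠ ⊤ → ((2 : ℕ) : ENNReal)⁻¹ * x ≠ ⊤ :=
      fun hx => ENNReal.mul_ne_top h2 hx
    have ha : ∀ {x y : ENNReal}, x ≠ ⊤ → y ≠ ⊤ → x + y ≠ ⊤ :=
      fun hx hy => ENNReal.add_ne_top.2 ⟨hx, hy⟩
    rw [ENNReal.toReal_add (hm (ha (hm (hfin _)) (hm (hfin _))))
        (hm (ha (hm (hfin _)) (hm (hfin _)))), ENNReal.toReal_mul, ENNReal.toReal_mul,
      ENNReal.toReal_add (hm (hfin _)) (hm (hfin _)),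
      ENNReal.toReal_add (hm (hfin _)) (hm (hfin _))]
    simp only [ENNReal.toReal_mul, ENNReal.toReal_inv, ENNReal.toReal_natCast]
    simp
    ring

variable {p : ℕ}

/-- The even steps of the random Lie bracket are the image of the logarithmic walk. -/
theorem lieBracketLaw_two_mul {A B : SL2Lie p} (hAB : ⁅A, B⁆ ≠ 0) (α β γ : ZMod n)
    (ι : ZMod n → ZMod p) (h0 : ι 0 = 1) (hadd : ∀ s t, ι (s + t) = ι s * ι t)
    (hα : ι α = bracketForm A A) (hβ : ι β = bracketForm B B) (hγ : ι γ = bracketForm A B)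
    (k : ℕ) :
    lieBracketLaw A B (2 * k) = (logWalk α β γ k).map fun t => ι t • ⁅A, B⁆ := by
  classical
  have hne : A ≠ B := fun h => hAB (by rw [h, lie_self])
  have hstep : ∀ k, lieBracketLaw A B (k + 1) = (lieBracketLaw A B k).bind fun X =>
      (PMF.uniformOfFintype Bool).map fun b => ⁅cond b A B, X⁆ := by
    intro k
    rw [lieBracketLaw]
    congr 1
    ext1 X
    have := map_cond_uniformOfFintype_bool hne ⟨A, Finset.mem_insert_self A {B}⟩
    convert congrArg (PMF.map fun Z => ⁅Z, X⁆) this using 1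
    rw [PMF.map_comp]
    rfl
  have hinc : ∀ b c t, ⁅cond c A B, ⁅cond b A B, ι t • ⁅A, B⁆⁆⁆ =
      ι (t + pairIncrement α β γ b c) • ⁅A, B⁆ := by
    intro b c t
    rw [double_bracket_smul, hadd, mul_comm]
    cases b <;> cases c <;> simp [pairIncrement, hα, hβ, hγ, bracketForm_comm B A]
  induction k with
  | zero => simp [lieBracketLaw, logWalk, PMF.pure_map, h0]
  | succ k ih =>
    rw [show 2 * (k + 1) = 2 * k + 1 + 1 by ring, hstep, hstep, ih, logWalk]
    simp only [PMF.map_bind, PMF.bind_map, PMF.bind_bind, PMF.map_comp, Function.comp_def, hinc]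
    simp only [← PMF.bind_pure_comp, Function.comp_def]
    -- `logWalk` draws both coins before the position, the bracket chain draws them after it.
    rw [PMF.bind_comm]
    congr 1
    ext1 b
    rw [PMF.bind_comm]

theorem tvDist_map_left {α β : Type*} [Fintype α] (μ : PMF α) (ν : PMF β) {f : α → β}
    (hf : Function.Injective f) (hν : ∀ x, x ∉ Set.range f → ν x = 0) :
    tvDist (μ.map f) ν = (1 / 2) * ∑ a, |(μ a).toReal - (ν (f a)).toReal| := by
  rw [tvDist, ← hf.tsum_eq]
  · rw [tsum_fintype]
    simp only [PMF.map_apply_of_injective μ hf]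
  · intro x hx
    by_contra hr
    apply hx
    have : (μ.map f) x = 0 := by
      rw [PMF.map_apply]
      simp only [ENNReal.tsum_eq_zero]
      intro a
      rw [if_neg fun h => hr ⟨a, h.symm⟩]
    simp [this, hν x hr]

theorem IsUniformOn.toReal_apply_of_mem {α : Type*} {ν : PMF α} {S : Set α} (h : IsUniformOn ν S)
    {x : α} (hx : x ∈ S) : (ν x).toReal = (Nat.card S : ℝ)⁻¹ := by
  obtain ⟨hfin, hne, rfl⟩ := h
  rw [PMF.uniformOfFinset_apply, if_pos (hfin.mem_toFinset.2 hx), ENNReal.toReal_inv,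
    ENNReal.toReal_natCast, Nat.card_coe_set_eq, Set.ncard_eq_toFinset_card S hfin]

theorem IsUniformOn.apply_of_notMem {α : Type*} {ν : PMF α} {S : Set α} (h : IsUniformOn ν S)
    {x : α} (hx : x ∉ S) : ν x = 0 := by
  obtain ⟨hfin, hne, rfl⟩ := h
  rw [PMF.uniformOfFinset_apply, if_neg fun h => hx (hfin.mem_toFinset.1 h)]

/-- Translation of total variation distances on the punctured line to `ZMod n`. -/
theorem tvDist_lieBracketLaw [Fact p.Prime] [NeZero n] {A B : SL2Lie p} (hAB : ⁅A, B⁆ ≠ 0)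
    (e : Multiplicative (ZMod n) ≃* (ZMod p)ˣ) (α β γ : ZMod n)
    (hα : (e (.ofAdd α) : ZMod p) = bracketForm A A)
    (hβ : (e (.ofAdd β) : ZMod p) = bracketForm B B)
    (hγ : (e (.ofAdd γ) : ZMod p) = bracketForm A B) (H : AddSubgroup (ZMod n))
    (k : ℕ) {ν : PMF (SL2Lie p)}
    (hν : IsUniformOn ν (onLine ⁅A, B⁆
      (e (.ofAdd γ) ^ k • ((AddSubgroup.toSubgroup H).map e.toMonoidHom : Set (ZMod p)ˣ)))) :
    tvDist (lieBracketLaw A B (2 * k)) ν =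
      (1 / 2) * ∑ t, |walkWeight α β γ k t - cosetWeight H (k • γ) t| := by
  set ι : ZMod n → SL2Lie p := fun t => (e (.ofAdd t) : ZMod p) • ⁅A, B⁆ with hι
  have hinj : Function.Injective ι := by
    intro s t h
    have h1 := smul_left_injective (ZMod p) hAB h
    simpa using e.injective (Units.ext h1)
  have hset : onLine ⁅A, B⁆
      (e (.ofAdd γ) ^ k • ((AddSubgroup.toSubgroup H).map e.toMonoidHom : Set (ZMod p)ˣ)) =
      ι '' {t | t - k • γ ∈ H} := by
    ext X
    constructor
    · rintro ⟨_, ⟨_, ⟨s, hs, rfl⟩, rfl⟩, rfl⟩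
      refine ⟨k • γ + s.toAdd, ?_, ?_⟩
      · change k • γ + s.toAdd - k • γ ∈ H
        rw [add_sub_cancel_left]
        exact hs
      · simp only [hι, ofAdd_add, ofAdd_nsmul, map_mul, map_pow]
        rfl
    · rintro ⟨t, ht, rfl⟩
      refine ⟨e (.ofAdd t), ⟨e (.ofAdd (t - k • γ)), ⟨.ofAdd (t - k • γ), ht, rfl⟩, ?_⟩, rfl⟩
      change e (.ofAdd γ) ^ k * e (.ofAdd (t - k • γ)) = _
      rw [← map_pow, ← map_mul, ← ofAdd_nsmul, ← ofAdd_add, add_sub_cancel]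
  rw [hset] at hν
  have hcard : Nat.card (ι '' {t | t - k • γ ∈ H}) = Nat.card H := by
    rw [Nat.card_image_of_injective hinj]
    exact Nat.card_congr ((Equiv.subRight (k • γ)).subtypeEquiv fun _ => Iff.rfl)
  rw [lieBracketLaw_two_mul hAB α β γ (fun t => (e (.ofAdd t) : ZMod p)) (by simp)
    (by intro s t; simp [ofAdd_add]) hα hβ hγ k,
    tvDist_map_left _ _ hinj fun x hx => hν.apply_of_notMem fun h => hx ?_]
  · congr 1
    refine Finset.sum_congr rfl fun t _ => ?_
    rw [toReal_logWalk]
    congr 2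
    unfold cosetWeight
    split_ifs with ht
    · rw [hν.toReal_apply_of_mem ⟨t, ht, rfl⟩, hcard]
    · rw [hν.apply_of_notMem fun ⟨s, hs, h⟩ => ht (hinj h ▸ hs), ENNReal.toReal_zero]
  · obtain ⟨t, -, rfl⟩ := h
    exact ⟨t, rfl⟩

end Law

/-! ### Equidistribution of the Gram matrix of a random pair -/

section Counting

variable {p : ℕ}

/-- Coordinates on trace-zero `2 × 2` matrices. -/
def sl2Equiv (p : ℕ) : SL2Lie p ≃ ZMod p × ZMod p × ZMod p where
  toFun A := (A.1 0 0, A.1 0 1, A.1 1 0)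
  invFun v := ⟨!![v.1, v.2.1; v.2.2, -v.1], by
    change Matrix.trace !![v.1, v.2.1; v.2.2, -v.1] = 0
    rw [Matrix.trace_fin_two]
    simp⟩
  left_inv A := sl2_ext rfl rfl rfl
  right_inv v := rfl

theorem card_sl2_prod : Nat.card (SL2Lie p × SL2Lie p) = p ^ 6 := by
  rw [Nat.card_prod, Nat.card_congr (sl2Equiv p), Nat.card_prod, Nat.card_prod, Nat.card_zmod]
  ring

variable [Fact p.Prime]

noncomputable instance : Fintype (SL2Lie p) := Fintype.ofEquiv _ (sl2Equiv p).symm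

open Classical in
theorem card_filter_zero_one_eq_zero :
    (Finset.univ.filter fun AB : SL2Lie p × SL2Lie p => AB.1.1 0 1 = 0).card ≤ p ^ 5 := by
  have h : (Finset.univ.filter fun AB : SL2Lie p × SL2Lie p => AB.1.1 0 1 = 0).card ≤
      (Finset.univ : Finset ((ZMod p × ZMod p) × ZMod p × ZMod p × ZMod p)).card := by
    refine Finset.card_le_card_of_injOn
      (fun AB => ((AB.1.1 0 0, AB.1.1 1 0), sl2Equiv p AB.2)) (fun _ _ => Finset.mem_univ _) ?_
    rintro ⟨A, B⟩ hA ⟨A', B'⟩ hA' h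
    simp only [Finset.coe_filter, Finset.mem_univ, true_and, Set.mem_ofPred_eq] at hA hA'
    simp only [Prod.mk.injEq, EmbeddingLike.apply_eq_iff_eq] at h
    exact Prod.ext (sl2_ext h.1.1 (hA.trans hA'.symm) h.1.2) h.2
  refine h.trans (le_of_eq ?_)
  simp only [Finset.card_univ, Fintype.card_prod, ZMod.card]
  ring

/-- Pairs with the same Gram matrix and the same three generic coordinates. -/
theorem eq_or_add_eq_of_bracketForm_eq (h2 : (2 : ZMod p) ≠ 0) {A B A' B' : SL2Lie p}
    (hy : A.1 0 1 ≠ 0) (h00 : A.1 0 0 = A'.1 0 0) (h01 : A.1 0 1 = A'.1 0 1)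
    (hB : B.1 0 1 = B'.1 0 1) (hα : bracketForm A A = bracketForm A' A')
    (hβ : bracketForm B B = bracketForm B' B') (hγ : bracketForm A B = bracketForm A' B') :
    A = A' ∧ (B.1 0 0 = B'.1 0 0 → B = B') ∧
      (B.1 0 0 = B'.1 0 0 ∨ A.1 0 1 * (B.1 0 0 + B'.1 0 0) = 2 * A.1 0 0 * B.1 0 1) := by
  have hA : A = A' := by
    refine sl2_ext h00 h01 ?_
    unfold bracketForm at hα
    rw [← h00, ← h01] at hα
    refine mul_left_cancel₀ (mul_ne_zero (mul_ne_zero h2 h2) hy) ?_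
    linear_combination hα
  subst hA
  unfold bracketForm at hβ hγ
  rw [← hB] at hβ hγ
  refine ⟨rfl, fun h => sl2_ext h hB ?_, ?_⟩
  · refine mul_left_cancel₀ (mul_ne_zero h2 hy) ?_
    rw [← h] at hγ
    linear_combination hγ
  -- Eliminating `B.1 1 0` from the two remaining Gram equations leaves a quadratic for `B.1 0 0`
  -- with leading coefficient `4 * A.1 0 1 ≠ 0`; a second root is fixed by the sum of the roots.
  · have h : (2 * 2) * ((B.1 0 0 - B'.1 0 0) *
        (A.1 0 1 * (B.1 0 0 + B'.1 0 0) - 2 * A.1 0 0 * B.1 0 1)) = 0 := by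
      linear_combination A.1 0 1 * hβ - 2 * B.1 0 1 * hγ
    rcases mul_eq_zero.1 ((mul_eq_zero.1 h).resolve_left (mul_ne_zero h2 h2)) with h | h
    · exact Or.inl (sub_eq_zero.1 h)
    · exact Or.inr (sub_eq_zero.1 h)

open Classical in
/-- The Gram matrix of a random pair is not concentrated. -/
theorem card_filter_bracketForm_mem_le (h2 : (2 : ZMod p) ≠ 0)
    (T : Finset (ZMod p × ZMod p × ZMod p)) :
    (Finset.univ.filter fun AB : SL2Lie p × SL2Lie p => AB.1.1 0 1 ≠ 0 ∧
      (bracketForm AB.1 AB.1, bracketForm AB.2 AB.2, bracketForm AB.1 AB.2) ∈ T).card ≤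
      2 * (p ^ 3 * T.card) := by
  set f : SL2Lie p × SL2Lie p → (ZMod p × ZMod p × ZMod p) × (ZMod p × ZMod p × ZMod p) :=
    fun AB => ((AB.1.1 0 0, AB.1.1 0 1, AB.2.1 0 1),
      (bracketForm AB.1 AB.1, bracketForm AB.2 AB.2, bracketForm AB.1 AB.2))
  have hcard : ((Finset.univ : Finset (ZMod p × ZMod p × ZMod p)) ×ˢ T).card = p ^ 3 * T.card := by
    simp only [Finset.card_product, Finset.card_univ, Fintype.card_prod, ZMod.card]
    ring
  rw [← hcard]
  refine Finset.card_le_mul_card_image_of_maps_to (f := f) ?_ 2 ?_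
  · intro AB hAB
    exact Finset.mem_product.2 ⟨Finset.mem_univ _, (Finset.mem_filter.1 hAB).2.2⟩
  · intro v _
    by_contra! hlt
    obtain ⟨P, hP, Q, hQ, R, hR, hPQ, hPR, hQR⟩ := Finset.two_lt_card.1 hlt
    have key : ∀ {P Q : SL2Lie p × SL2Lie p}, P.1.1 0 1 ≠ 0 → f P = v → f Q = v → P ≠ Q →
        P.2.1 0 0 ≠ Q.2.1 0 0 ∧ P.1.1 0 1 * (P.2.1 0 0 + Q.2.1 0 0) = 2 * P.1.1 0 0 * P.2.1 0 1 := by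
      intro P Q hy hP hQ hne
      have h := hP.trans hQ.symm
      simp only [f, Prod.mk.injEq] at h
      obtain ⟨⟨h1, h2', h3⟩, h4, h5, h6⟩ := h
      obtain ⟨hA, hB, hor⟩ := eq_or_add_eq_of_bracketForm_eq h2 hy h1 h2' h3 h4 h5 h6
      have hx : P.2.1 0 0 ≠ Q.2.1 0 0 := fun h => hne (Prod.ext hA (hB h))
      exact ⟨hx, hor.resolve_left hx⟩
    simp only [Finset.mem_filter, Finset.mem_univ, true_and] at hP hQ hR
    have k1 := key hP.1.1 hP.2 hQ.2 hPQ
    have k2 := key hP.1.1 hP.2 hR.2 hPR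
    exact (key hQ.1.1 hQ.2 hR.2 hQR).1 (add_left_cancel (mul_left_cancel₀ hP.1.1 (k1.2.trans k2.2.symm)))

open Classical in
/-- A property of pairs which holds as soon as the Gram matrix is non-degenerate and the logarithms
of the two ratios of its entries avoid a small set has large probability. -/
theorem le_pairProb {n : ℕ} [NeZero n] (hp : 2 < p) (hn : n ≤ p)
    (e : Multiplicative (ZMod n) ≃* (ZMod p)ˣ) (E : Finset (ZMod n × ZMod n))
    {P : SL2Lie p → SL2Lie p → Prop}
    (hP : ∀ A B : SL2Lie p, ∀ α β γ : ZMod n, ⁅A, B⁆ ≠ 0 →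
      (e (.ofAdd α) : ZMod p) = bracketForm A A → (e (.ofAdd β) : ZMod p) = bracketForm B B →
      (e (.ofAdd γ) : ZMod p) = bracketForm A B → (α - γ, β - γ) ∉ E → P A B) :
    1 - (9 / p + 2 * E.card / p ^ 2) ≤ pairProb p P := by
  have h2 : (2 : ZMod p) ≠ 0 := by
    intro h
    have : ((2 : ℕ) : ZMod p) = 0 := by exact_mod_cast h
    rw [ZMod.natCast_eq_zero_iff] at this
    exact absurd (Nat.le_of_dvd two_pos this) (by omega)
  set U : Finset (ZMod p × ZMod p) := Finset.univ
  have hU : U.card = p ^ 2 := by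
    simp only [U, Finset.card_univ, Fintype.card_prod, ZMod.card]; ring
  -- Bad Gram data: a zero entry, a zero determinant (forced by `⁅A, B⁆ = 0`), or logarithms `(x +
  -- γ, y + γ, γ)` with `(x, y) ∈ E`. The four degenerate families cost `8 / p` and the pairs with
  -- `A.1 0 1 = 0` cost `1 / p`, whence `9 / p`.
  set T : Finset (ZMod p × ZMod p × ZMod p) :=
    U.image (fun s => (0, s.1, s.2)) ∪ (U.image (fun s => (s.1, 0, s.2)) ∪
      (U.image (fun s => (s.1, s.2, 0)) ∪ (U.image (fun s => (s.1, s.2 ^ 2 / s.1, s.2)) ∪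
        (E ×ˢ (Finset.univ : Finset (ZMod n))).image fun s =>
          ((e (.ofAdd (s.1.1 + s.2)) : ZMod p), (e (.ofAdd (s.1.2 + s.2)) : ZMod p),
            (e (.ofAdd s.2) : ZMod p))))) with hTdef
  have hT : T.card ≤ 4 * p ^ 2 + p * E.card := by
    have h1 : ((E ×ˢ (Finset.univ : Finset (ZMod n))).image fun s =>
          ((e (.ofAdd (s.1.1 + s.2)) : ZMod p), (e (.ofAdd (s.1.2 + s.2)) : ZMod p),
            (e (.ofAdd s.2) : ZMod p))).card ≤ p * E.card := by
      refine Finset.card_image_le.trans ?_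
      rw [Finset.card_product, Finset.card_univ, ZMod.card, mul_comm]
      gcongr
    have hi : ∀ f : ZMod p × ZMod p → ZMod p × ZMod p × ZMod p, (U.image f).card ≤ p ^ 2 :=
      fun f => Finset.card_image_le.trans hU.le
    have u1 := (Finset.card_union_le (U.image fun s => ((s.1, s.2 ^ 2 / s.1, s.2) :
      ZMod p × ZMod p × ZMod p)) _).trans (add_le_add (hi _) h1)
    have u2 := (Finset.card_union_le (U.image fun s => ((s.1, s.2, 0) :
      ZMod p × ZMod p × ZMod p)) _).trans (add_le_add (hi _) u1)
    have u3 := (Finset.card_union_le (U.image fun s => ((s.1, 0, s.2) :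
      ZMod p × ZMod p × ZMod p)) _).trans (add_le_add (hi _) u2)
    have u4 := (Finset.card_union_le (U.image fun s => ((0, s.1, s.2) :
      ZMod p × ZMod p × ZMod p)) _).trans (add_le_add (hi _) u3)
    rw [hTdef]
    refine u4.trans (le_of_eq ?_)
    ring
  set Bad : Finset (SL2Lie p × SL2Lie p) := Finset.univ.filter fun AB => ¬ P AB.1 AB.2
  have hlog : ∀ u : ZMod p, u ≠ 0 → ∃ α : ZMod n, (e (.ofAdd α) : ZMod p) = u := by
    intro u hu
    refine ⟨(e.symm (Units.mk0 u hu)).toAdd, ?_⟩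
    simp
  have hsub : Bad ⊆ (Finset.univ.filter fun AB : SL2Lie p × SL2Lie p => AB.1.1 0 1 = 0) ∪
      (Finset.univ.filter fun AB : SL2Lie p × SL2Lie p => AB.1.1 0 1 ≠ 0 ∧
        (bracketForm AB.1 AB.1, bracketForm AB.2 AB.2, bracketForm AB.1 AB.2) ∈ T) := by
    rintro ⟨A, B⟩ hAB
    have hnP : ¬ P A B := (Finset.mem_filter.1 hAB).2
    rw [Finset.mem_union, Finset.mem_filter, Finset.mem_filter]
    by_cases hy : A.1 0 1 = 0
    · exact Or.inl ⟨Finset.mem_univ _, hy⟩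
    refine Or.inr ⟨Finset.mem_univ _, hy, ?_⟩
    change (bracketForm A A, bracketForm B B, bracketForm A B) ∈ T
    simp only [hTdef, Finset.mem_union, Finset.mem_image]
    by_cases ha : bracketForm A A = 0
    · exact Or.inl ⟨(bracketForm B B, bracketForm A B), Finset.mem_univ _, by rw [ha]⟩
    by_cases hb : bracketForm B B = 0
    · exact Or.inr (Or.inl ⟨(bracketForm A A, bracketForm A B), Finset.mem_univ _, by rw [hb]⟩)
    by_cases hc : bracketForm A B = 0
    · exact Or.inr (Or.inr (Or.inl
        ⟨(bracketForm A A, bracketForm B B), Finset.mem_univ _, by rw [hc]⟩))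
    by_cases hV : ⁅A, B⁆ = 0
    · refine Or.inr (Or.inr (Or.inr (Or.inl
        ⟨(bracketForm A A, bracketForm A B), Finset.mem_univ _, ?_⟩)))
      rw [← bracketForm_mul_self_of_bracket_eq_zero A B hV]
      simp [mul_div_cancel_left₀ _ ha]
    obtain ⟨α, hα⟩ := hlog _ ha
    obtain ⟨β, hβ⟩ := hlog _ hb
    obtain ⟨γ, hγ⟩ := hlog _ hc
    refine Or.inr (Or.inr (Or.inr (Or.inr ⟨((α - γ, β - γ), γ), ?_, ?_⟩)))
    · refine Finset.mem_product.2 ⟨?_, Finset.mem_univ _⟩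
      by_contra hE
      exact hnP (hP A B α β γ hV hα hβ hγ hE)
    · simp only [sub_add_cancel, hα, hβ, hγ]
  have hBad : Bad.card ≤ p ^ 5 + 2 * (p ^ 3 * (4 * p ^ 2 + p * E.card)) := by
    refine (Finset.card_le_card hsub).trans ((Finset.card_union_le _ _).trans
      (add_le_add card_filter_zero_one_eq_zero
        ((card_filter_bracketForm_mem_le h2 T).trans ?_)))
    gcongr
  have hgood : Nat.card {AB : SL2Lie p × SL2Lie p // P AB.1 AB.2} + Bad.card = p ^ 6 := by
    rw [Nat.card_eq_fintype_card, Fintype.card_subtype, ← card_sl2_prod (p := p),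
      Nat.card_eq_fintype_card, ← Finset.card_univ]
    exact Finset.card_filter_add_card_filter_not _
  have hpR : (0 : ℝ) < p := by exact_mod_cast (by omega : 0 < p)
  have hgoodR : (Nat.card {AB : SL2Lie p × SL2Lie p // P AB.1 AB.2} : ℝ) + Bad.card = p ^ 6 := by
    exact_mod_cast hgood
  have hBadR : (Bad.card : ℝ) ≤ p ^ 5 + 2 * (p ^ 3 * (4 * p ^ 2 + p * E.card)) := by
    exact_mod_cast hBad
  rw [pairProb, card_sl2_prod, Nat.cast_pow, le_div_iff₀ (by positivity)]
  have e1 : (1 - (9 / p + 2 * E.card / p ^ 2)) * (p : ℝ) ^ 6 =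
      p ^ 6 - (p ^ 5 + 2 * (p ^ 3 * (4 * p ^ 2 + p * E.card))) := by
    field_simp
    ring
  rw [e1]
  linarith

end Counting

/-! ### Exceptional increments, limiting laws and the choice of constants -/

section Main

variable {n : ℕ} [NeZero n]

open Classical in
/-- The increments for which the walk on `ZMod n` misbehaves: they generate a subgroup of index at
least `M`, or the walk has not mixed after `k` steps. -/
noncomputable def exceptionalIncrements (n : ℕ) [NeZero n] (M k : ℕ) (η : ℝ) :
    Finset (ZMod n × ZMod n) :=
  (Finset.univ.filter fun xy : ZMod n × ZMod n =>
    M * Nat.card (AddSubgroup.closure {xy.1, xy.2}) ≤ n) ∪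
  Finset.univ.filter fun xy : ZMod n × ZMod n => η < spectralSum xy.1 xy.2 k

theorem spectralSum_nonneg (x y : ZMod n) (k : ℕ) : 0 ≤ spectralSum x y k :=
  Finset.sum_nonneg fun _ _ => by positivity

/-- The second term is Markov's inequality for the spectral sum. -/
theorem card_exceptionalIncrements_le {M k : ℕ} (hM : 0 < M) (hk : 0 < k) {η : ℝ} (hη : 0 < η) :
    ((exceptionalIncrements n M k η).card : ℝ) ≤ 2 / M * n ^ 2 + 12 * n ^ 3 / (k * η) := by
  classical
  have h1 : ((Finset.univ.filter fun xy : ZMod n × ZMod n =>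
      η < spectralSum xy.1 xy.2 k).card : ℝ) ≤ 12 * n ^ 3 / (k * η) := by
    rw [← div_div, le_div_iff₀ hη]
    refine le_trans ?_ (sum_spectralSum_le (n := n) hk)
    rw [← Fintype.sum_prod_type', ← nsmul_eq_mul, ← Finset.sum_const]
    refine (Finset.sum_le_sum fun xy hxy => (Finset.mem_filter.1 hxy).2.le).trans ?_
    exact Finset.sum_le_sum_of_subset_of_nonneg (Finset.filter_subset _ _)
      fun _ _ _ => spectralSum_nonneg _ _ _
  have h2 := card_filter_card_closure_le (n := n) hM
  have h3 : ((exceptionalIncrements n M k η).card : ℝ) ≤ _ := Nat.cast_le.2 (Finset.card_union_le _ _)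
  rw [Nat.cast_add] at h3
  convert h3.trans (add_le_add _ h1)
  convert h2

variable {p : ℕ} [Fact p.Prime]

/-- The limiting coset distributions of the random Lie bracket. -/
theorem exists_limiting_distribution (e : Multiplicative (ZMod n) ≃* (ZMod p)ˣ)
    (A B : SL2Lie p) :
    ∃ ν : ℕ → PMF (SL2Lie p), (∃ (H : Subgroup (ZMod p)ˣ) (g : (ZMod p)ˣ), ∀ k : ℕ,
        IsUniformOn (ν k) (onLine ⁅A, B⁆ (g ^ k • (H : Set (ZMod p)ˣ)))) ∧
      ∀ α β γ : ZMod n, (e (.ofAdd α) : ZMod p) = bracketForm A A →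
        (e (.ofAdd β) : ZMod p) = bracketForm B B → (e (.ofAdd γ) : ZMod p) = bracketForm A B →
        ∀ k, IsUniformOn (ν k) (onLine ⁅A, B⁆ (e (.ofAdd γ) ^ k •
          ((AddSubgroup.toSubgroup (AddSubgroup.closure {α - γ, β - γ})).map e.toMonoidHom :
            Set (ZMod p)ˣ))) := by
  have hex : ∀ (H : Subgroup (ZMod p)ˣ) (g : (ZMod p)ˣ), ∃ ν : ℕ → PMF (SL2Lie p), ∀ k : ℕ,
      IsUniformOn (ν k) (onLine ⁅A, B⁆ (g ^ k • (H : Set (ZMod p)ˣ))) := by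
    intro H g
    have hfin : ∀ k, (onLine ⁅A, B⁆ (g ^ k • (H : Set (ZMod p)ˣ))).Finite := fun k =>
      (Set.toFinite _).image _
    have hne : ∀ k, (hfin k).toFinset.Nonempty := fun k => by
      rw [Set.Finite.toFinset_nonempty]
      exact Set.Nonempty.image _ ⟨_, Set.smul_mem_smul_set H.one_mem⟩
    exact ⟨fun k => PMF.uniformOfFinset _ (hne k), fun k => ⟨hfin k, hne k, rfl⟩⟩
  by_cases h : ∃ α β γ : ZMod n, (e (.ofAdd α) : ZMod p) = bracketForm A A ∧
        (e (.ofAdd β) : ZMod p) = bracketForm B B ∧ (e (.ofAdd γ) : ZMod p) = bracketForm A B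
  · obtain ⟨α, β, γ, hα, hβ, hγ⟩ := h
    obtain ⟨ν, hν⟩ := hex ((AddSubgroup.toSubgroup (AddSubgroup.closure {α - γ, β - γ})).map
      e.toMonoidHom) (e (.ofAdd γ))
    refine ⟨ν, ⟨_, _, hν⟩, fun α' β' γ' hα' hβ' hγ' => ?_⟩
    have hinj : ∀ {s t : ZMod n}, (e (.ofAdd s) : ZMod p) = e (.ofAdd t) → s = t := fun h =>
      Multiplicative.ofAdd.injective (e.injective (Units.ext h))
    obtain rfl := hinj (hα.trans hα'.symm)
    obtain rfl := hinj (hβ.trans hβ'.symm)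
    obtain rfl := hinj (hγ.trans hγ'.symm)
    exact hν
  -- If some form value is zero there is no logarithmic walk to match, so any coset will do.
  · obtain ⟨ν, hν⟩ := hex ⊤ 1
    exact ⟨ν, ⟨_, _, hν⟩, fun α β γ hα hβ hγ => absurd ⟨α, β, γ, hα, hβ, hγ⟩ h⟩

end Main

theorem theorem1 (δ ε : ℝ) (hδ : 0 < δ) (hε : 0 < ε) :
    ∃ C c : ℝ, 0 < C ∧ 0 < c ∧
      ∀ (p : ℕ) [Fact p.Prime], C < (p : ℝ) →
        -- `ν A B k` is the limiting distribution of the walk after `2 * k` steps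
        ∃ ν : SL2Lie p → SL2Lie p → ℕ → PMF (SL2Lie p),
          (∀ A B : SL2Lie p, ⁅A, B⁆ ≠ 0 →
            ∃ (H : Subgroup (ZMod p)ˣ) (g : (ZMod p)ˣ), ∀ k : ℕ,
              IsUniformOn (ν A B k) (onLine ⁅A, B⁆ (g ^ k • (H : Set (ZMod p)ˣ)))) ∧
          1 - δ ≤ pairProb p (fun A B =>
            ⁅A, B⁆ ≠ 0 ∧
            Tendsto (fun k : ℕ => tvDist (lieBracketLaw A B (2 * k)) (ν A B k)) atTop (𝓝 0) ∧
            (∀ k : ℕ, (k : ℝ) < c * p →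
              1 - ε < tvDist (lieBracketLaw A B (2 * k)) (ν A B k)) ∧
            (∀ k : ℕ, C * p < (k : ℝ) →
              tvDist (lieBracketLaw A B (2 * k)) (ν A B k) < ε)) := by
  obtain ⟨M, hM⟩ := exists_nat_gt (16 / δ)
  have hMR : (0 : ℝ) < M := lt_trans (by positivity) hM
  have hMpos : 0 < M := by exact_mod_cast hMR
  -- The summands serve in turn: `p > 2`; absorbing the additive 3 of the lower bound; `9 / p ≤ δ /
  -- 4`; and the Markov term at most `δ / 8 * n ^ 2`. With `2 / M ≤ δ / 8` the total failure
  -- probability is at most `3δ / 4`.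
  set C : ℝ := 2 + 24 * M / ε + 36 / δ + 96 / (δ * ε ^ 2) with hC
  have hC1 : 0 < 24 * M / ε := by positivity
  have hC2 : 0 < 36 / δ := by positivity
  have hC3 : 0 < 96 / (δ * ε ^ 2) := by positivity
  have hCpos : 0 < C := by positivity
  refine ⟨C, ε ^ 2 / (96 * M), hCpos, by positivity, fun p _ hp => ?_⟩
  have hpR : (0 : ℝ) < p := hCpos.trans hp
  have hp2 : 2 < p := by
    have : (2 : ℝ) < p := by linarith
    exact_mod_cast this
  set n := Nat.card (ZMod p)ˣ with hn
  have hnp : n = p - 1 := by rw [hn, Nat.card_eq_fintype_card, ZMod.card_units]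
  have : NeZero n := ⟨by omega⟩
  have hnle : (n : ℝ) ≤ p := by exact_mod_cast (by omega : n ≤ p)
  have hnge : (p : ℝ) ≤ 2 * n := by exact_mod_cast (by omega : p ≤ 2 * n)
  have hnR : (0 : ℝ) < n := by linarith
  set e : Multiplicative (ZMod n) ≃* (ZMod p)ˣ := zmodCyclicMulEquiv inferInstance
  choose ν hν hνlog using exists_limiting_distribution (p := p) e
  refine ⟨ν, fun A B _ => hν A B, ?_⟩
  set k₀ := ⌈C * p⌉₊ with hk₀
  have hk₀R : C * p ≤ k₀ := Nat.le_ceil _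
  have hk₀pos : 0 < k₀ := Nat.ceil_pos.2 (by positivity)
  set E := exceptionalIncrements n M k₀ (ε ^ 2) with hE
  have hEcard : (E.card : ℝ) ≤ 2 / M * n ^ 2 + 12 * n ^ 3 / (k₀ * ε ^ 2) :=
    card_exceptionalIncrements_le hMpos hk₀pos (by positivity)
  refine le_trans ?_ (le_pairProb hp2 (by omega) e E ?_)
  · have h1 : 9 / (p : ℝ) ≤ δ / 4 := by
      rw [div_le_div_iff₀ hpR (by norm_num)]
      have : 36 / δ ≤ p := by linarith
      rw [div_le_iff₀ hδ] at this
      linarith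
    have h2 : (E.card : ℝ) ≤ δ / 4 * p ^ 2 := by
      have e1 : 2 / (M : ℝ) ≤ δ / 8 := by
        rw [div_lt_iff₀ hδ] at hM
        rw [div_le_div_iff₀ hMR (by norm_num)]
        linarith
      have e2 : 12 * (n : ℝ) ^ 3 / (k₀ * ε ^ 2) ≤ δ / 8 * n ^ 2 := by
        have h96 : 96 / (δ * ε ^ 2) ≤ C := by linarith
        rw [div_le_iff₀ (by positivity)] at h96
        have hkn : C * n ≤ k₀ := le_trans (by gcongr) hk₀R
        rw [div_le_iff₀ (by positivity)]
        calc 12 * (n : ℝ) ^ 3 = (96 * n) * (n ^ 2 / 8) := by ring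
          _ ≤ (C * (δ * ε ^ 2) * n) * (n ^ 2 / 8) := by gcongr
          _ = (C * n) * (δ / 8 * n ^ 2 * ε ^ 2) := by ring
          _ ≤ k₀ * (δ / 8 * n ^ 2 * ε ^ 2) := by gcongr
          _ = δ / 8 * n ^ 2 * (k₀ * ε ^ 2) := by ring
      calc (E.card : ℝ) ≤ δ / 8 * n ^ 2 + δ / 8 * n ^ 2 :=
            hEcard.trans (add_le_add (by gcongr) e2)
        _ = δ / 4 * n ^ 2 := by ring
        _ ≤ δ / 4 * p ^ 2 := by gcongr
    have h3 : 2 * (E.card : ℝ) / p ^ 2 ≤ δ / 2 := by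
      rw [div_le_iff₀ (by positivity)]
      linarith
    linarith
  · intro A B α β γ hV hα hβ hγ hgood
    have htv : ∀ k, tvDist (lieBracketLaw A B (2 * k)) (ν A B k) = (1 / 2) * ∑ t,
        |walkWeight α β γ k t - cosetWeight (AddSubgroup.closure {α - γ, β - γ}) (k • γ) t| :=
      fun k => tvDist_lieBracketLaw hV e α β γ hα hβ hγ _ k (hνlog A B α β γ hα hβ hγ k)
    have hsqrt : ∀ k, ∑ t,
        |walkWeight α β γ k t - cosetWeight (AddSubgroup.closure {α - γ, β - γ}) (k • γ) t| ≤
        √(spectralSum (α - γ) (β - γ) k) := fun k =>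
      Real.le_sqrt_of_sq_le (sq_sum_abs_sub_le_spectralSum α β γ k)
    rw [hE, exceptionalIncrements, Finset.mem_union, not_or, Finset.mem_filter,
      Finset.mem_filter] at hgood
    simp only [Finset.mem_univ, true_and, not_le, not_lt] at hgood
    obtain ⟨hindex, hmix⟩ := hgood
    refine ⟨hV, ?_, fun k hk => ?_, fun k hk => ?_⟩
    · have hlim : Tendsto (fun k => (1 / 2) * √(spectralSum (α - γ) (β - γ) k)) atTop (𝓝 0) := by
        have := (Real.continuous_sqrt.tendsto 0).comp (tendsto_spectralSum (α - γ) (β - γ))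
        rw [Real.sqrt_zero] at this
        simpa using this.const_mul (1 / 2 : ℝ)
      refine squeeze_zero (fun k => ?_) (fun k => ?_) hlim
      · rw [htv]; positivity
      · rw [htv]; gcongr; exact hsqrt k
    · rw [htv]
      -- `K = 4 / ε` loses `ε / 4` outside the small set. The set has less than `ε / 2` of the
      -- coset's mass, since `k < c * p` and `p < 2 * M * h`.
      refine lt_of_lt_of_le ?_ (le_half_sum_abs_sub_cosetWeight α β γ _ _ k
        (K := 4 / ε) (by positivity))
      set h := Nat.card (AddSubgroup.closure {α - γ, β - γ})
      have hh : (p : ℝ) < 2 * (M * h) := by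
        have : (n : ℝ) < M * h := by exact_mod_cast hindex
        linarith
      have hhpos : (0 : ℝ) < h := by exact_mod_cast Nat.card_pos
      have hkp : 96 * M * k < ε ^ 2 * p := by
        rw [div_mul_eq_mul_div, lt_div_iff₀ (by positivity)] at hk
        linarith
      have hpε : 24 * M < ε * p := by
        have : 24 * M / ε < p := by linarith
        rw [div_lt_iff₀ hε] at this
        linarith
      have h1 : (3 * (4 / ε) * k + 3) / h < ε / 2 := by
        rw [div_lt_iff₀ hhpos]
        have h12 : 3 * (4 / ε) * k < ε * p / (8 * M) := by
          rw [lt_div_iff₀ (by positivity)]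
          have : 3 * (4 / ε) * k * (8 * M) = 96 * M * k / ε := by field_simp; ring
          rw [this, div_lt_iff₀ hε]
          linarith
        have h13 : 3 < ε * p / (8 * M) := by
          rw [lt_div_iff₀ (by positivity)]
          linarith
        have h14 : ε * p / (8 * M) ≤ ε / 4 * h := by
          rw [div_le_iff₀ (by positivity)]
          calc ε * p ≤ ε * (2 * (M * h)) := by gcongr
            _ = ε / 4 * h * (8 * M) := by ring
        linarith
      rw [one_div_div]
      linarith
    · rw [htv]
      have hle : k₀ ≤ k := Nat.ceil_le.2 hk.le
      -- Mixing at the single time `k₀` suffices, because the spectral sum decreases in `k`.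
      have h1 : √(spectralSum (α - γ) (β - γ) k) ≤ ε :=
        Real.sqrt_le_iff.2 ⟨hε.le, (spectralSum_antitone _ _ hle).trans hmix⟩
      linarith [hsqrt k]
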